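/- Let $(M,\omega)$ be a connected symplectic manifold without boundary (not necessarily compact), and let $\mathrm{Ham}^c(M)$ be its group of compactly supported Hamiltonian symplectomorphisms. For a smooth function $h$ on $M$, let $X_h$ be the vector field with $\omega(X_h,\cdot)=dh$, and put $$\mathrm{minset}\,h=\{x\in M: h(x)=\min h\},\qquad \mathrm{maxset}\,h=\{x\in M: h(x)=\max h\},\qquad \mathrm{Totvar}\,h=\sup_M h-\inf_M h.$$ Smooth families $\{H_t\}_{t\in[0,1]}$ of functions on $M$ are taken to be smooth on $[0,1]\times M$ with supports in a common compact set. A smooth isotopy $\gamma=\{\phi_t\}_{t\in[0,1]}$ in $\mathrm{Ham}^c(M)$ is generated by the family $\{H_t\}$ if $\frac{d}{dt}\phi_t(x)=X_{H_t}(\phi_t(x))$ for all $t\in[0,1]$, $x\in M$; its Hofer length is then $\mathcal L(\gamma)=\int_0^1\mathrm{Totvar}\,H_t\,dt$. For a smooth family $\{G_t\}_{t\in[0,1]}$ with $G_0=G_1=0$ and $\varepsilon\in\mathbf R$, let $\gamma_\varepsilon=\{\phi_{\varepsilon G_t}\circ\phi_t\}_{t\in[0,1]}$, where, for each fixed $t$,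 $\phi_{\varepsilon G_t}$ is the time-$1$ flow of $X_{\varepsilon G_t}$. The isotopy $\gamma$ is called a smooth point of $\mathcal L$ if for every such $\{G_t\}$ the function $\varepsilon\mapsto\mathcal L(\gamma_\varepsilon)$ is differentiable at $\varepsilon=0$. Proposition. Let $\gamma=\{\phi_t\}_{t\in[0,1]}$ be a smooth isotopy in $\mathrm{Ham}^c(M)$ generated by $\{H_t\}_{t\in[0,1]}$, with at least one fixed minimum and at least one fixed maximum, i.e. $\bigcap_{t\in[0,1]}\mathrm{minset}\,H_t\neq\emptyset$ and $\bigcap_{t\in[0,1]}\mathrm{maxset}\,H_t\neq\emptyset$. If $\gamma$ is a smooth point of $\mathcal L$, then there are points $p,P\in M$ such that $$\bigcap_{t\in[0,1]}\mathrm{minset}\,H_t=\{p\}\quad\text{and}\quad\bigcap_{t\in[0,1]}\mathrm{maxset}\,H_t=\{P\},$$ and such that $\mathrm{minset}\,H_t=\{p\}$ and $\mathrm{maxset}\,H_t=\{P\}$ for all $t\in[0,1]$ outside a set of measure $0$. -/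

import Mathlib

open Set MeasureTheory
open scoped Manifold ContDiff

noncomputable section

namespace HoferGeometry

variable {E : Type*} [NormedAddCommGroup E] [NormedSpace ℝ E] [FiniteDimensional ℝ E]
  {M : Type*} [TopologicalSpace M] [ChartedSpace E M]

/-- A field of alternating bilinear forms on the tangent spaces of `M`. -/
abbrev TwoFormField (E : Type*) [NormedAddCommGroup E] [NormedSpace ℝ E]
    (M : Type*) [TopologicalSpace M] [ChartedSpace E M] : Type _ :=
  (x : M) → (TangentSpace 𝓘(ℝ, E) x) [⋀^Fin 2]→L[ℝ] ℝ

/-- The expression of a field of 2-forms in a chart `c`: its pullback under `c⁻¹`. -/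
def chartExpr (Ω : TwoFormField E M) (c : OpenPartialHomeomorph M E) :
    E → E [⋀^Fin 2]→L[ℝ] ℝ :=
  fun y => (Ω (c.symm y)).compContinuousLinearMap (mfderiv 𝓘(ℝ, E) 𝓘(ℝ, E) c.symm y)

/-- A symplectic form on `M`: a smooth, closed, nondegenerate 2-form. -/
structure SymplecticForm (E : Type*) [NormedAddCommGroup E] [NormedSpace ℝ E]
    (M : Type*) [TopologicalSpace M] [ChartedSpace E M] where
  form : TwoFormField E M
  smooth : ∀ c ∈ atlas E M, ContDiffOn ℝ ∞ (chartExpr form c) c.target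
  closed : ∀ c ∈ atlas E M, ∀ y ∈ c.target, extDeriv (chartExpr form c) y = 0
  nondegenerate : ∀ (x : M) (u : TangentSpace 𝓘(ℝ, E) x),
    (∀ v : TangentSpace 𝓘(ℝ, E) x, form x ![u, v] = 0) → u = 0

theorem update_zero {V : Type*} (a b c : V) : Function.update ![a, b] 0 c = ![c, b] := by
  funext i
  fin_cases i <;> simp

theorem update_one {V : Type*} (a b c : V) : Function.update ![a, b] 1 c = ![a, c] := by
  funext i
  fin_cases i <;> simp

/-- The linear map `u ↦ A(u, ·)` of an alternating bilinear form `A`. -/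
def flat {V : Type*} [AddCommGroup V] [Module ℝ V] [TopologicalSpace V]
    (A : V [⋀^Fin 2]→L[ℝ] ℝ) : V →ₗ[ℝ] Module.Dual ℝ V :=
  LinearMap.mk₂ ℝ (fun u v => A ![u, v])
    (fun a b v => by
      simpa only [update_zero] using A.map_update_add ![0, v] 0 a b)
    (fun r a v => by
      simpa only [update_zero] using A.map_update_smul ![0, v] 0 r a)
    (fun u a b => by
      simpa only [update_one] using A.map_update_add ![u, 0] 1 a b)
    (fun r u a => by
      simpa only [update_one] using A.map_update_smul ![u, 0] 1 r a)

/-- By nondegeneracy, every covector is of the form `Ω(u, ·)`. -/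
theorem SymplecticForm.exists_eq (Ω : SymplecticForm E M) (x : M)
    (l : TangentSpace 𝓘(ℝ, E) x →L[ℝ] ℝ) :
    ∃ u : TangentSpace 𝓘(ℝ, E) x,
      ∀ v : TangentSpace 𝓘(ℝ, E) x, Ω.form x ![u, v] = l v := by
  have hfin : FiniteDimensional ℝ (TangentSpace 𝓘(ℝ, E) x) := inferInstanceAs (FiniteDimensional ℝ E)
  have hB : Function.Injective (flat (Ω.form x)) := by
    rw [injective_iff_map_eq_zero]
    intro u hu
    exact Ω.nondegenerate x u fun v => LinearMap.congr_fun hu v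
  have hs : Function.Surjective (flat (Ω.form x)) :=
    (LinearMap.injective_iff_surjective_of_finrank_eq_finrank
      (Subspace.dual_finrank_eq (K := ℝ) (V := TangentSpace 𝓘(ℝ, E) x)).symm).1 hB
  obtain ⟨u, hu⟩ := hs l.toLinearMap
  exact ⟨u, fun v => LinearMap.congr_fun hu v⟩

/-- The symplectic gradient `X_h` of `h`, the vector field with `Ω(X_h, ·) = dh`. -/
def sympGrad (Ω : SymplecticForm E M) (h : M → ℝ) (x : M) : TangentSpace 𝓘(ℝ, E) x :=
  (Ω.exists_eq x (mfderiv 𝓘(ℝ, E) 𝓘(ℝ, ℝ) h x)).choose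

theorem sympGrad_spec (Ω : SymplecticForm E M) (h : M → ℝ) (x : M)
    (v : TangentSpace 𝓘(ℝ, E) x) :
    Ω.form x ![sympGrad Ω h x, v] = mfderiv 𝓘(ℝ, E) 𝓘(ℝ, ℝ) h x v :=
  (Ω.exists_eq x (mfderiv 𝓘(ℝ, E) 𝓘(ℝ, ℝ) h x)).choose_spec v

open Classical in
/-- The flow at time `s` of the autonomous Hamiltonian `h`: follow for time `s` the integral curve
of `X_h` through `x`. If there is no integral curve defined on all of `ℝ` (which does not occur for
smooth compactly supported `h`), the value is `x`. -/
def hamFlow (Ω : SymplecticForm E M) (h : M → ℝ) (s : ℝ) (x : M) : M :=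
  if hc : ∃ c : ℝ → M, c 0 = x ∧ IsMIntegralCurve c (I := 𝓘(ℝ, E)) (sympGrad Ω h) then
    hc.choose s
  else x

/-- A smooth family `H_t`, `t ∈ [0,1]`, of functions supported in a common compact set. -/
structure IsSmoothCompactFamily (E : Type*) [NormedAddCommGroup E] [NormedSpace ℝ E]
    {M : Type*} [TopologicalSpace M] [ChartedSpace E M] (H : ℝ → M → ℝ) : Prop where
  smooth : ContMDiffOn (𝓘(ℝ, ℝ).prod 𝓘(ℝ, E)) 𝓘(ℝ, ℝ) ∞
    (fun z : ℝ × M => H z.1 z.2) (Icc 0 1 ×ˢ univ)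
  compact : ∃ K : Set M, IsCompact K ∧ ∀ t ∈ Icc (0 : ℝ) 1, ∀ x ∉ K, H t x = 0

/-- At time `t`, the velocity of the path `γ` of maps of `M` is the symplectic gradient of `h`:
`(d/dt) γ_t(x) = X_h(γ_t(x))` for all `x` (one-sided derivatives at `t = 0, 1`). -/
def HasHamVelocityAt (Ω : SymplecticForm E M) (γ : ℝ → M → M) (h : M → ℝ) (t : ℝ) : Prop :=
  ∀ x : M, HasMFDerivWithinAt 𝓘(ℝ, ℝ) 𝓘(ℝ, E) (fun s : ℝ => γ s x) (Icc 0 1) t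
    ((1 : ℝ →L[ℝ] ℝ).smulRight (sympGrad Ω h (γ t x)))

/-- The smooth isotopy `φ_t`, `t ∈ [0,1]`, is generated by the Hamiltonian `H_t`. -/
structure IsGeneratedBy (Ω : SymplecticForm E M)
    (φ : ℝ → Diffeomorph 𝓘(ℝ, E) 𝓘(ℝ, E) M M ∞) (H : ℝ → M → ℝ) : Prop where
  smooth : ContMDiffOn (𝓘(ℝ, ℝ).prod 𝓘(ℝ, E)) 𝓘(ℝ, E) ∞
    (fun z : ℝ × M => φ z.1 z.2) (Icc 0 1 ×ˢ univ)
  family : IsSmoothCompactFamily E H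
  velocity : ∀ t ∈ Icc (0 : ℝ) 1, HasHamVelocityAt Ω (fun s => φ s) (H t) t

/-- The group `Ham^c(M)` of compactly supported Hamiltonian symplectomorphisms, as a set: the
endpoints of the Hamiltonian isotopies that start at the identity. -/
def hamGroup (Ω : SymplecticForm E M) : Set (Diffeomorph 𝓘(ℝ, E) 𝓘(ℝ, E) M M ∞) :=
  {ψ | ∃ φ H, IsGeneratedBy Ω φ H ∧ φ 0 = Diffeomorph.refl 𝓘(ℝ, E) M ∞ ∧ φ 1 = ψ}

/-- `Totvar h = sup h - inf h`. -/
def totVar (h : M → ℝ) : ℝ := (⨆ x, h x) - ⨅ x, h x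

/-- The Hofer norm of the velocity of `γ` at time `t`: the total variation of a smooth compactly
supported function whose symplectic gradient is that velocity. On a connected manifold this
function is unique up to a constant when `γ_t` is a bijection, so the set has exactly one element
and `sInf` returns it. -/
def hoferSpeed (Ω : SymplecticForm E M) (γ : ℝ → M → M) (t : ℝ) : ℝ :=
  sInf {r | ∃ h : M → ℝ, ContMDiff 𝓘(ℝ, E) 𝓘(ℝ, ℝ) ∞ h ∧ HasCompactSupport h ∧
    HasHamVelocityAt Ω γ h t ∧ r = totVar h}

/-- The Hofer length of the path `γ_t`, `t ∈ [0,1]`. -/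
def hoferLength (Ω : SymplecticForm E M) (γ : ℝ → M → M) : ℝ :=
  ∫ t in (0 : ℝ)..1, hoferSpeed Ω γ t

/-- Tangent vectors to the space of paths with fixed endpoints. -/
def IsTangentField (E : Type*) [NormedAddCommGroup E] [NormedSpace ℝ E]
    {M : Type*} [TopologicalSpace M] [ChartedSpace E M] (G : ℝ → M → ℝ) : Prop :=
  IsSmoothCompactFamily E G ∧ (∀ x, G 0 x = 0) ∧ ∀ x, G 1 x = 0

/-- The path `γ_ε(t) = φ_{εG_t} ∘ φ_t`, where `φ_{εG_t}` is the time-1 flow of `εG_t`. -/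
def deformedPath (Ω : SymplecticForm E M) (φ : ℝ → M → M) (G : ℝ → M → ℝ) (ε : ℝ) :
    ℝ → M → M :=
  fun t x => hamFlow Ω (fun y => ε * G t y) 1 (φ t x)

/-- `φ` is a smooth point of the length functional. -/
def IsSmoothPoint (Ω : SymplecticForm E M) (φ : ℝ → M → M) : Prop :=
  ∀ G : ℝ → M → ℝ, IsTangentField E G →
    DifferentiableAt ℝ (fun ε : ℝ => hoferLength Ω (deformedPath Ω φ G ε)) 0

/-- The set where `h` attains its minimum. -/
def minset (h : M → ℝ) : Set M := {x | ∀ y, h x ≤ h y}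

/-- The set where `h` attains its maximum. -/
def maxset (h : M → ℝ) : Set M := {x | ∀ y, h y ≤ h x}

end HoferGeometry

end

open HoferGeometry

/-! The total variation is convex in the function, and it has a corner in the direction `g` at `h`
as soon as `g` takes two values on `minset h` or on `maxset h`. If `x` and `y` are minima and `P` is
a maximum of `h`, then testing `h + r g` on the pair `P`, `x` and `h - r g` on `P`, `y` gives
`Totvar(h + r g) + Totvar(h - r g) - 2 Totvar h ≥ r (g y - g x)`; maxima are symmetric
(`mul_sub_le_of_mem_minset`, `mul_sub_le_of_mem_maxset`).

The isotopy is deformed by `G_t = t(1-t) g` with `g` independent of `t`. All the flows involved are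
then one flow `ψ` of `g` at rescaled times. Since `ψ` preserves `g`, the deformed path has speed
`Totvar(H_t + ε(1-2t) g)` at time `t` (`hoferSpeed_deformedPath`). Differentiability of the length
at `ε = 0` makes the integrals of the rescaled second differences tend to `0`. These are nonnegative
and bound `(1-2t)(g y - g x)` from above, so `g` is constant on `minset H_t` and on `maxset H_t` for
almost every `t` (`ae_constant_on_minset_maxset`). Choosing `g` equal to `1` exactly at a fixed
minimum, then exactly at a fixed maximum, gives the theorem.

The rest constructs `ψ`. A bump function in a chart has a compactly supported Hamiltonian field on
the model space. Its flow is global, smooth by the implicit function theorem on a space of curves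
(`IsFlow.contDiff`), and symplectic (`IsSymplecticOn.flow_preserves`); it is carried to the manifold
by the chart (`isHamFlow_chartFlow`). -/

noncomputable section

namespace HoferGeometry

set_option linter.unusedSectionVars false

/-! ### Smoothness of the superposition operator on spaces of continuous maps. -/

section Superposition

universe u

/-- The superposition operator `c ↦ Y ∘ c` on continuous maps. -/
def superposition {K : Type*} [TopologicalSpace K] {E F : Type*} [TopologicalSpace E] [TopologicalSpace F] (Y : C(E, F)) :
    C(K, E) → C(K, F) := fun c => Y.comp c

/-- Pointwise evaluation of a continuous family of continuous linear maps. -/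
def pointwiseApply (K : Type*) [TopologicalSpace K] [CompactSpace K]
    (E F : Type*) [NormedAddCommGroup E] [NormedSpace ℝ E]
    [NormedAddCommGroup F] [NormedSpace ℝ F] :
    C(K, E →L[ℝ] F) →L[ℝ] C(K, E) →L[ℝ] C(K, F) :=
  LinearMap.mkContinuous₂
    (LinearMap.mk₂ ℝ
      (fun (A : C(K, E →L[ℝ] F)) (c : C(K, E)) => (⟨fun k => A k (c k), by fun_prop⟩ : C(K, F)))
      (fun _ _ _ => by ext; simp) (fun _ _ _ => by ext; simp)
      (fun _ _ _ => by ext; simp) (fun _ _ _ => by ext; simp)) 1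
    (fun A c => by
      rw [ContinuousMap.norm_le _ (by positivity), one_mul]
      intro k
      exact ((A k).le_opNorm _).trans
        (mul_le_mul (A.norm_coe_le_norm k) (c.norm_coe_le_norm k) (norm_nonneg (c k)) (norm_nonneg A)))

variable {K : Type*} [TopologicalSpace K] [CompactSpace K]

theorem pointwiseApply_apply {E F : Type*} [NormedAddCommGroup E] [NormedSpace ℝ E]
    [NormedAddCommGroup F] [NormedSpace ℝ F] (A : C(K, E →L[ℝ] F)) (c : C(K, E)) (k : K) :
    pointwiseApply K E F A c k = A k (c k) := rfl

theorem norm_pointwiseApply_le {E F : Type*} [NormedAddCommGroup E] [NormedSpace ℝ E]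
    [NormedAddCommGroup F] [NormedSpace ℝ F] (A : C(K, E →L[ℝ] F)) :
    ‖pointwiseApply K E F A‖ ≤ ‖A‖ := by
  refine ContinuousLinearMap.opNorm_le_bound _ (norm_nonneg A) fun c => ?_
  rw [ContinuousMap.norm_le _ (by positivity)]
  intro k
  exact ((A k).le_opNorm _).trans
    (mul_le_mul (A.norm_coe_le_norm k) (c.norm_coe_le_norm k) (norm_nonneg (c k)) (norm_nonneg A))

variable {E F : Type u} [NormedAddCommGroup E] [NormedSpace ℝ E]
  [NormedAddCommGroup F] [NormedSpace ℝ F]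

/-- Compact support makes `fderiv ℝ Y` uniformly continuous, so the mean value inequality on balls
of one radius `δ` bounds the remainder uniformly in `k`. -/
theorem hasFDerivAt_superposition {Y : E → F} (hY : ContDiff ℝ ∞ Y) (hc : HasCompactSupport Y)
    (c : C(K, E)) :
    HasFDerivAt (superposition (K := K) ⟨Y, hY.continuous⟩)
      (pointwiseApply K E F
        (superposition ⟨fderiv ℝ Y, hY.continuous_fderiv (by simp)⟩ c)) c := by
  have hD : Continuous (fderiv ℝ Y) := hY.continuous_fderiv (by simp)
  have hu : UniformContinuous (fderiv ℝ Y) :=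
    hD.uniformContinuous_of_tendsto_cocompact (hc.fderiv (𝕜 := ℝ)).is_zero_at_infty
  rw [hasFDerivAt_iff_isLittleO_nhds_zero, Asymptotics.isLittleO_iff]
  intro ε hε
  obtain ⟨δ, hδ, H⟩ := Metric.uniformContinuous_iff.1 hu ε hε
  filter_upwards [Metric.ball_mem_nhds (0 : C(K, E)) hδ] with h hh
  rw [ContinuousMap.norm_le _ (by positivity)]
  intro k
  have hk : ‖h k‖ < δ := (h.norm_coe_le_norm k).trans_lt (by simpa using hh)
  have key : ‖Y (c k + h k) - Y (c k) - fderiv ℝ Y (c k) (c k + h k - c k)‖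
      ≤ ε * ‖c k + h k - c k‖ := by
    refine (convex_ball (c k) δ).norm_image_sub_le_of_norm_fderiv_le' (𝕜 := ℝ)
      (fun x _ => (hY.differentiable (by simp)).differentiableAt) (fun x hx => ?_)
      (Metric.mem_ball_self hδ) (by simpa using hk)
    rw [← dist_eq_norm]
    exact (H hx).le
  have h2 : ε * ‖h k‖ ≤ ε * ‖h‖ := by gcongr; exact h.norm_coe_le_norm k
  refine le_trans ?_ h2
  simpa [superposition, pointwiseApply_apply] using key

/-- The derivative is again a superposition operator, by `fderiv ℝ Y`, followed by a continuous
linear map. The target changes from `F` to `E →L[ℝ] F`, so `F` is quantified inside the induction.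
-/
theorem contDiff_superposition_nat (n : ℕ) : ∀ {F : Type u} [NormedAddCommGroup F]
    [NormedSpace ℝ F] {Y : E → F} (hY : ContDiff ℝ ∞ Y) (_ : HasCompactSupport Y),
    ContDiff ℝ n (superposition (K := K) ⟨Y, hY.continuous⟩) := by
  induction n with
  | zero =>
    intro F _ _ Y hY hc
    exact contDiff_zero.2 (ContinuousMap.continuous_postcomp _)
  | succ n ih =>
    intro F _ _ Y hY hc
    have hD : ContDiff ℝ ∞ (fderiv ℝ Y) := hY.fderiv_right (by simp)
    rw [Nat.cast_succ, contDiff_succ_iff_hasFDerivAt]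
    exact ⟨_, (pointwiseApply K E F).contDiff.comp (ih hD (hc.fderiv (𝕜 := ℝ))),
      hasFDerivAt_superposition hY hc⟩

theorem contDiff_superposition {Y : E → F} (hY : ContDiff ℝ ∞ Y) (hc : HasCompactSupport Y) :
    ContDiff ℝ ∞ (superposition (K := K) ⟨Y, hY.continuous⟩) :=
  contDiff_infty.2 fun n => contDiff_superposition_nat n hY hc

end Superposition

/-! ### Global existence and smoothness of flows of compactly supported fields. -/

section Flow

open scoped unitInterval

variable {E : Type*} [NormedAddCommGroup E] [NormedSpace ℝ E]

/-- Integration from `0` on the space of continuous curves `[0,1] → E`. -/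
def primitiveCLM (E : Type*) [NormedAddCommGroup E] [NormedSpace ℝ E] [CompleteSpace E] :
    C(I, E) →L[ℝ] C(I, E) :=
  LinearMap.mkContinuous
    { toFun := fun c => ⟨fun s => ∫ r in (0 : ℝ)..s, c (projIcc 0 1 zero_le_one r), by
        have h : Continuous fun r : ℝ => c (projIcc 0 1 zero_le_one r) := by fun_prop
        exact (intervalIntegral.continuous_primitive (fun a b => h.intervalIntegrable a b) 0).comp
          continuous_subtype_val⟩
      map_add' := fun c d => by
        ext s
        have h (c : C(I, E)) : Continuous fun r : ℝ => c (projIcc 0 1 zero_le_one r) := by fun_prop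
        exact intervalIntegral.integral_add ((h c).intervalIntegrable _ _)
          ((h d).intervalIntegrable _ _)
      map_smul' := fun a c => by
        ext s
        exact intervalIntegral.integral_smul _ _ }
    1 (fun c => by
      rw [ContinuousMap.norm_le _ (by positivity)]
      intro s
      refine (intervalIntegral.norm_integral_le_of_norm_le_const
        (C := ‖c‖) fun r _ => c.norm_coe_le_norm _).trans ?_
      rw [sub_zero, abs_of_nonneg s.2.1, one_mul]
      exact mul_le_of_le_one_right (norm_nonneg _) s.2.2)

theorem primitiveCLM_apply [CompleteSpace E] (c : C(I, E)) (s : I) :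
    primitiveCLM E c s = ∫ r in (0 : ℝ)..s, c (projIcc 0 1 zero_le_one r) := rfl

theorem norm_primitiveCLM_le [CompleteSpace E] : ‖primitiveCLM E‖ ≤ 1 :=
  LinearMap.mkContinuous_norm_le _ zero_le_one _

variable {Y : E → E}

theorem exists_lipschitzWith_of_hasCompactSupport (hY : ContDiff ℝ ∞ Y) (hc : HasCompactSupport Y) :
    ∃ L : NNReal, LipschitzWith L Y ∧ ∀ x, ‖fderiv ℝ Y x‖ ≤ L := by
  obtain ⟨C, hC⟩ := (hY.continuous_fderiv (by simp)).bounded_above_of_compact_support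
    (hc.fderiv (𝕜 := ℝ))
  have hC0 : 0 ≤ C := (norm_nonneg _).trans (hC 0)
  refine ⟨⟨C, hC0⟩, lipschitzWith_of_nnnorm_fderiv_le (𝕜 := ℝ)
    (hY.differentiable (by simp)) fun x => ?_, hC⟩
  exact_mod_cast hC x

/-- The field is bounded by `B` and globally Lipschitz, so Picard–Lindelöf applies on every `[-a,
a]` with the ball of radius `B * a`. Uniqueness glues the solutions. -/
theorem exists_global_solution [CompleteSpace E] (hY : ContDiff ℝ ∞ Y) (hc : HasCompactSupport Y) (x : E) :
    ∃ c : ℝ → E, c 0 = x ∧ ∀ s, HasDerivAt c (Y (c s)) s := by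
  obtain ⟨L, hL, -⟩ := exists_lipschitzWith_of_hasCompactSupport hY hc
  obtain ⟨B, hB⟩ := hY.continuous.bounded_above_of_compact_support hc
  have hB0 : 0 ≤ B := (norm_nonneg _).trans (hB 0)
  have hloc : ∀ a : ℝ, ∃ c : ℝ → E, c 0 = x ∧ ∀ s ∈ Ioo (-a) a, HasDerivAt c (Y (c s)) s := by
    intro a
    rcases le_or_gt a 0 with ha | ha
    · exact ⟨fun _ => x, rfl, fun s hs => absurd (hs.1.trans hs.2) (by linarith)⟩
    have h : IsPicardLindelof (fun _ => Y) (tmin := -a) (tmax := a)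
        ⟨0, by constructor <;> linarith⟩ x (⟨B, hB0⟩ * ⟨a, ha.le⟩) 0 ⟨B, hB0⟩ L :=
      IsPicardLindelof.of_time_independent (fun y _ => hB y) hL.lipschitzOnWith (by
        simp only [sub_zero, zero_sub, neg_neg, max_self, NNReal.coe_zero]; exact le_refl (B * a))
    obtain ⟨c, hc0, hc1⟩ := h.exists_eq_forall_mem_Icc_hasDerivWithinAt₀
    exact ⟨c, hc0, fun s hs => (hc1 s (Ioo_subset_Icc_self hs)).hasDerivAt
      (Icc_mem_nhds hs.1 hs.2)⟩
  choose c hc0 hc1 using hloc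
  have huniq : ∀ a b s : ℝ, s ∈ Ioo (-a) a → s ∈ Ioo (-b) b → c a s = c b s := by
    intro a b s ha hb
    have hab : s ∈ Ioo (-(min a b)) (min a b) := by
      simp only [mem_Ioo] at *
      constructor
      · rcases min_choice a b with h | h <;> rw [h] <;> linarith
      · exact lt_min ha.2 hb.2
    have h0 : (0 : ℝ) ∈ Ioo (-(min a b)) (min a b) := by
      have : 0 < min a b := by have := hab.1.trans hab.2; linarith
      constructor <;> linarith
    refine ODE_solution_unique_of_mem_Ioo (v := fun _ => Y) (s := fun _ => univ) (K := L)
      (fun _ _ => hL.lipschitzOnWith) h0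
      (fun r hr => ⟨hc1 a r ⟨?_, hr.2.trans_le (min_le_left _ _)⟩, mem_univ _⟩)
      (fun r hr => ⟨hc1 b r ⟨?_, hr.2.trans_le (min_le_right _ _)⟩, mem_univ _⟩)
      ((hc0 a).trans (hc0 b).symm) hab
    · exact (neg_le_neg (min_le_left a b)).trans_lt hr.1
    · exact (neg_le_neg (min_le_right a b)).trans_lt hr.1
  -- The window `|s| + 1` keeps `s` interior; near `s` the glued curve agrees with one fixed
  -- solution by `huniq`.
  refine ⟨fun s => c (|s| + 1) s, hc0 _, fun s => ?_⟩
  have hs : s ∈ Ioo (-(|s| + 1)) (|s| + 1) := abs_lt.1 (lt_add_one _)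
  refine (hc1 (|s| + 1) s hs).congr_of_eventuallyEq ?_
  filter_upwards [Ioo_mem_nhds hs.1 hs.2] with r hr
  exact huniq _ _ _ (abs_lt.1 (lt_add_one _)) hr

/-- A global flow of the vector field `Y`. -/
structure IsFlow (Y : E → E) (Ψ : ℝ × E → E) : Prop where
  zero : ∀ x, Ψ (0, x) = x
  deriv : ∀ s x, HasDerivAt (fun s => Ψ (s, x)) (Y (Ψ (s, x))) s

theorem IsFlow.eq_of_hasDerivAt {L : NNReal} (hL : LipschitzWith L Y) {Ψ : ℝ × E → E}
    (h : IsFlow Y Ψ) {c : ℝ → E} (hc : ∀ s, HasDerivAt c (Y (c s)) s) (s : ℝ) :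
    c s = Ψ (s, c 0) :=
  congrFun (ODE_solution_unique_univ (v := fun _ => Y) (s := fun _ => univ) (K := L) (t₀ := 0)
    (fun _ => hL.lipschitzOnWith) (fun s => ⟨hc s, mem_univ _⟩)
    (fun s => ⟨h.deriv s (c 0), mem_univ _⟩) (h.zero _).symm) s

theorem IsFlow.add {L : NNReal} (hL : LipschitzWith L Y) {Ψ : ℝ × E → E}
    (h : IsFlow Y Ψ) (s t : ℝ) (x : E) : Ψ (s + t, x) = Ψ (s, Ψ (t, x)) := by
  have := h.eq_of_hasDerivAt hL (c := fun s => Ψ (s + t, x))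
    (fun s => (h.deriv (s + t) x).comp_add_const s t) s
  simpa using this

theorem IsFlow.fixed {L : NNReal} (hL : LipschitzWith L Y) {Ψ : ℝ × E → E}
    (h : IsFlow Y Ψ) {x : E} (hx : Y x = 0) (s : ℝ) : Ψ (s, x) = x :=
  (h.eq_of_hasDerivAt hL (c := fun _ => x) (fun s => by rw [hx]; exact hasDerivAt_const s x) s).symm

theorem IsFlow.hasDerivAt_comp_mul {Ψ : ℝ × E → E} (h : IsFlow Y Ψ) (τ : ℝ) (x : E) (s : ℝ) :
    HasDerivAt (fun s => Ψ (s * τ, x)) (τ • Y (Ψ (s * τ, x))) s := by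
  simpa [Function.comp_def] using (h.deriv (s * τ) x).scomp s ((hasDerivAt_id s).mul_const τ)

variable [CompleteSpace E]

/-- The operator whose zeros are the solutions of `c' = τ Y(c)`, `c(0) = x`. -/
def solutionDefect (hY : Continuous Y) (z : (ℝ × E) × C(I, E)) : C(I, E) :=
  z.2 - ContinuousMap.const I z.1.2 - z.1.1 • primitiveCLM E (superposition ⟨Y, hY⟩ z.2)

theorem contDiff_solutionDefect (hY : ContDiff ℝ ∞ Y) (hc : HasCompactSupport Y) :
    ContDiff ℝ ∞ (solutionDefect hY.continuous) := by
  have h1 : ContDiff ℝ ∞ fun z : (ℝ × E) × C(I, E) =>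
      superposition (K := I) ⟨Y, hY.continuous⟩ z.2 :=
    (contDiff_superposition hY hc).comp contDiff_snd
  have h2 : ContDiff ℝ ∞ fun z : (ℝ × E) × C(I, E) => ContinuousMap.const I z.1.2 :=
    (ContinuousLinearMap.const ℝ I : E →L[ℝ] C(I, E)).contDiff.comp (contDiff_snd.comp contDiff_fst)
  unfold solutionDefect
  exact (contDiff_snd.sub h2).sub ((contDiff_fst.comp contDiff_fst).smul
    ((primitiveCLM E).contDiff.comp h1))

theorem isInvertible_one_sub {V : Type*} [NormedAddCommGroup V] [NormedSpace ℝ V] [CompleteSpace V]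
    {A : V →L[ℝ] V} (hA : ‖A‖ < 1) :
    (ContinuousLinearMap.id ℝ V - A).IsInvertible := by
  obtain ⟨u, hu⟩ := isUnit_one_sub_of_norm_lt_one hA
  exact ⟨ContinuousLinearEquiv.unitsEquiv ℝ V u, by ext x; exact congrArg (fun B => B x) hu⟩

/-- The partial derivative in the curve is the identity minus `τ` times integration after
multiplication by `fderiv ℝ Y`, an operator of norm at most `|τ| L < 1`. -/
theorem isInvertible_fderiv_solutionDefect (hY : ContDiff ℝ ∞ Y) (hc : HasCompactSupport Y)
    {L : NNReal} (hL : ∀ x, ‖fderiv ℝ Y x‖ ≤ L) {z : ℝ × E} (hz : |z.1| * L < 1) (c : C(I, E)) :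
    (fderiv ℝ (solutionDefect hY.continuous) (z, c) ∘L .inr ℝ (ℝ × E) C(I, E)).IsInvertible := by
  have h1 : HasFDerivAt (fun c => solutionDefect hY.continuous (z, c))
      (fderiv ℝ (solutionDefect hY.continuous) (z, c) ∘L .inr ℝ (ℝ × E) C(I, E)) c :=
    HasFDerivAt.comp (g := solutionDefect hY.continuous) c
      ((contDiff_solutionDefect hY hc).differentiable (by simp) (z, c)).hasFDerivAt
      (hasFDerivAt_prodMk_right z c)
  set A := pointwiseApply I E E
    (superposition ⟨fderiv ℝ Y, hY.continuous_fderiv (by simp)⟩ c) with hA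
  have h3 : HasFDerivAt (superposition (K := I) ⟨Y, hY.continuous⟩) A c :=
    hasFDerivAt_superposition hY hc c
  have hAn : ‖A‖ ≤ L := (norm_pointwiseApply_le _).trans
    ((ContinuousMap.norm_le _ L.2).2 fun k => hL _)
  clear_value A
  have h4 : HasFDerivAt (fun c => primitiveCLM E (superposition ⟨Y, hY.continuous⟩ c))
      (primitiveCLM E ∘L A) c := (primitiveCLM E).hasFDerivAt.comp c h3
  have h2 : HasFDerivAt (fun c => solutionDefect hY.continuous (z, c))
      (ContinuousLinearMap.id ℝ C(I, E) - z.1 • (primitiveCLM E ∘L A)) c :=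
    ((hasFDerivAt_id c).sub_const (ContinuousMap.const I z.2)).sub (h4.const_smul z.1)
  rw [h1.unique h2]
  apply isInvertible_one_sub
  rw [norm_smul, Real.norm_eq_abs]
  refine lt_of_le_of_lt ?_ hz
  gcongr
  refine (ContinuousLinearMap.opNorm_comp_le _ _).trans ?_
  simpa using mul_le_mul norm_primitiveCLM_le hAn (norm_nonneg A) zero_le_one

/-- The orbit of `x`, run over the time interval `[0, τ]`, as a curve on `[0,1]`. -/
def IsFlow.orbit {Ψ : ℝ × E → E} (h : IsFlow Y Ψ) (z : ℝ × E) : C(I, E) :=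
  ⟨fun s => Ψ (s * z.1, z.2), by
    have : Continuous fun s : ℝ => Ψ (s * z.1, z.2) :=
      continuous_iff_continuousAt.2 fun s => (h.hasDerivAt_comp_mul z.1 z.2 s).continuousAt
    exact this.comp continuous_subtype_val⟩

theorem IsFlow.solutionDefect_orbit (hY : Continuous Y) {Ψ : ℝ × E → E} (h : IsFlow Y Ψ)
    (z : ℝ × E) : solutionDefect hY (z, h.orbit z) = 0 := by
  ext s
  have hcont : Continuous fun s : ℝ => Ψ (s * z.1, z.2) :=
    continuous_iff_continuousAt.2 fun s => (h.hasDerivAt_comp_mul z.1 z.2 s).continuousAt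
  have h1 : ∫ r in (0 : ℝ)..s, z.1 • Y (Ψ (r * z.1, z.2)) = Ψ (s * z.1, z.2) - z.2 := by
    rw [intervalIntegral.integral_eq_sub_of_hasDerivAt
      (fun r _ => h.hasDerivAt_comp_mul z.1 z.2 r)
      (((hY.comp hcont).const_smul z.1).intervalIntegrable _ _), zero_mul, h.zero]
  have h2 : primitiveCLM E (superposition ⟨Y, hY⟩ (h.orbit z)) s
      = ∫ r in (0 : ℝ)..s, Y (Ψ (r * z.1, z.2)) := by
    rw [primitiveCLM_apply]
    refine intervalIntegral.integral_congr fun r hr => ?_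
    rw [uIcc_of_le s.2.1] at hr
    have hr' : r ∈ Icc (0 : ℝ) 1 := ⟨hr.1, hr.2.trans s.2.2⟩
    simp [superposition, IsFlow.orbit, projIcc_of_mem _ hr']
  have h3 : solutionDefect hY (z, h.orbit z) s
      = Ψ (s * z.1, z.2) - z.2 - z.1 • ∫ r in (0 : ℝ)..s, Y (Ψ (r * z.1, z.2)) := by
    rw [← h2]; rfl
  rw [h3, ← intervalIntegral.integral_smul, h1]
  simp

/-- Contraction with factor `|τ| L < 1`. This global uniqueness identifies the implicit function
with the orbit, without knowing beforehand that orbits depend continuously on `z`. -/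
theorem eq_of_solutionDefect_eq (hY : Continuous Y) {L : NNReal} (hL : LipschitzWith L Y)
    {z : ℝ × E} (hz : |z.1| * L < 1) {c d : C(I, E)}
    (h : solutionDefect hY (z, c) = solutionDefect hY (z, d)) : c = d := by
  have h1 : c - d = z.1 • primitiveCLM E
      (superposition ⟨Y, hY⟩ c - superposition ⟨Y, hY⟩ d) := by
    rw [map_sub, smul_sub]
    simp only [solutionDefect] at h
    rw [sub_eq_sub_iff_sub_eq_sub] at h
    rw [← h]
    abel
  have h2 : ‖superposition ⟨Y, hY⟩ c - superposition ⟨Y, hY⟩ d‖ ≤ L * ‖c - d‖ := by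
    rw [ContinuousMap.norm_le _ (by positivity)]
    intro k
    calc ‖Y (c k) - Y (d k)‖ ≤ L * ‖c k - d k‖ := hL.norm_sub_le _ _
      _ ≤ L * ‖c - d‖ := by gcongr; exact (c - d).norm_coe_le_norm k
  have h3 : ‖c - d‖ ≤ |z.1| * L * ‖c - d‖ := by
    calc ‖c - d‖ = |z.1| * ‖primitiveCLM E
              (superposition ⟨Y, hY⟩ c - superposition ⟨Y, hY⟩ d)‖ := by
          conv_lhs => rw [h1]
          rw [norm_smul, Real.norm_eq_abs]
      _ ≤ |z.1| * (1 * (L * ‖c - d‖)) := by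
          gcongr
          exact ((primitiveCLM E).le_opNorm _).trans
            (mul_le_mul norm_primitiveCLM_le h2 (norm_nonneg _) zero_le_one)
      _ = |z.1| * L * ‖c - d‖ := by ring
  have h4 : ‖c - d‖ = 0 := by
    by_contra hne
    have : 0 < ‖c - d‖ := lt_of_le_of_ne (norm_nonneg _) (Ne.symm hne)
    nlinarith
  exact sub_eq_zero.1 (norm_eq_zero.1 h4)

theorem IsFlow.contDiffAt_of_small (hY : ContDiff ℝ ∞ Y) (hc : HasCompactSupport Y)
    {L : NNReal} (hL : LipschitzWith L Y) (hL' : ∀ x, ‖fderiv ℝ Y x‖ ≤ L)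
    {Ψ : ℝ × E → E} (h : IsFlow Y Ψ) {z : ℝ × E} (hz : |z.1| * L < 1) : ContDiffAt ℝ ∞ Ψ z := by
  have hD : ContDiffAt ℝ ∞ (solutionDefect hY.continuous) (z, h.orbit z) :=
    (contDiff_solutionDefect hY hc).contDiffAt
  have hI := isInvertible_fderiv_solutionDefect hY hc hL' hz (h.orbit z)
  have h1 := hD.contDiffAt_implicitFunction (by simp) hI
  have h2 := hD.eventually_apply_implicitFunction (by simp) hI
  have h3 : ∀ᶠ w : ℝ × E in nhds z, |w.1| * L < 1 :=
    ContinuousAt.eventually_lt (by fun_prop) continuousAt_const hz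
  have h4 : ∀ᶠ w in nhds z, Ψ w = hD.implicitFunction (by simp) hI w 1 := by
    filter_upwards [h2, h3] with w hw hw'
    have := eq_of_solutionDefect_eq hY.continuous hL hw'
      (hw.trans ((h.solutionDefect_orbit hY.continuous z).trans
        (h.solutionDefect_orbit hY.continuous w).symm))
    rw [this]
    simp [IsFlow.orbit]
  exact ((ContinuousMap.evalCLM ℝ (1 : I) : C(I, E) →L[ℝ] E).contDiff.contDiffAt.comp z h1).congr_of_eventuallyEq h4

/-- The flow of a smooth compactly supported vector field is smooth. -/
theorem IsFlow.contDiff (hY : ContDiff ℝ ∞ Y) (hc : HasCompactSupport Y)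
    {Ψ : ℝ × E → E} (h : IsFlow Y Ψ) : ContDiff ℝ ∞ Ψ := by
  obtain ⟨L, hL, hL'⟩ := exists_lipschitzWith_of_hasCompactSupport hY hc
  -- The implicit function theorem covers times with `|s| L < 1`; writing the time-`s` map as the
  -- square of the time-`s/2` map doubles the range at each stage.
  have key : ∀ n : ℕ, ∀ z : ℝ × E, |z.1| * L < 2 ^ n → ContDiffAt ℝ ∞ Ψ z := by
    intro n
    induction n with
    | zero => exact fun z hz => h.contDiffAt_of_small hY hc hL hL' (by simpa using hz)
    | succ n ih =>
      intro z hz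
      have hlt : |z.1 / 2| * L < 2 ^ n := by
        rw [abs_div, abs_two]; rw [pow_succ] at hz; linarith
      have hEq : Ψ = fun w : ℝ × E => Ψ (w.1 / 2, Ψ (w.1 / 2, w.2)) := by
        ext w
        rw [← h.add hL, add_halves]
      have hin : ContDiffAt ℝ ∞ (fun w : ℝ × E => (w.1 / 2, w.2)) z := by fun_prop
      have h1 : ContDiffAt ℝ ∞ (fun w : ℝ × E => Ψ (w.1 / 2, w.2)) z :=
        ContDiffAt.comp (g := Ψ) z (ih (z.1 / 2, z.2) hlt) hin
      rw [hEq]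
      exact ContDiffAt.comp (g := Ψ) z (ih (z.1 / 2, Ψ (z.1 / 2, z.2)) hlt)
        (ContDiffAt.prodMk (by fun_prop) h1)
  rw [contDiff_iff_contDiffAt]
  intro z
  obtain ⟨n, hn⟩ := pow_unbounded_of_one_lt (|z.1| * L) one_lt_two
  exact key n z hn

theorem exists_isFlow (hY : ContDiff ℝ ∞ Y) (hc : HasCompactSupport Y) :
    ∃ Ψ : ℝ × E → E, IsFlow Y Ψ := by
  choose c hc0 hc1 using exists_global_solution hY hc
  exact ⟨fun z => c z.2 z.1, hc0, fun s x => hc1 x s⟩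

end Flow

/-! ### Hamiltonian flows on an open subset of the model space. -/

section LocalSymplectic

variable {E : Type*} [NormedAddCommGroup E] [NormedSpace ℝ E] [FiniteDimensional ℝ E]

/-- The continuous linear map `u ↦ A(u, ·)` of an alternating bilinear form `A`. -/
def flatCLM (A : E [⋀^Fin 2]→L[ℝ] ℝ) : E →L[ℝ] E →L[ℝ] ℝ :=
  LinearMap.toContinuousLinearMap
    ((LinearMap.toContinuousLinearMap : (E →ₗ[ℝ] ℝ) ≃ₗ[ℝ] (E →L[ℝ] ℝ)).toLinearMap ∘ₗ flat A)

theorem flatCLM_apply (A : E [⋀^Fin 2]→L[ℝ] ℝ) (u v : E) : flatCLM A u v = A ![u, v] := rfl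

theorem isInvertible_flatCLM {A : E [⋀^Fin 2]→L[ℝ] ℝ}
    (hA : ∀ u : E, (∀ v : E, A ![u, v] = 0) → u = 0) : (flatCLM A).IsInvertible := by
  have hinj : Function.Injective (flatCLM A) := by
    rw [injective_iff_map_eq_zero]
    exact fun u hu => hA u fun v => by rw [← flatCLM_apply, hu]; rfl
  have hrank : Module.finrank ℝ E = Module.finrank ℝ (E →L[ℝ] ℝ) := by
    rw [← Subspace.dual_finrank_eq (K := ℝ) (V := E)]
    exact (LinearMap.toContinuousLinearMap : (E →ₗ[ℝ] ℝ) ≃ₗ[ℝ] (E →L[ℝ] ℝ)).finrank_eq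
  exact ⟨((flatCLM A).toLinearMap.linearEquivOfInjective hinj hrank).toContinuousLinearEquiv,
    by ext u v; rfl⟩

/-- The Hamiltonian vector field of `f` with respect to the field of forms `η`. -/
def hamField (η : E → E [⋀^Fin 2]→L[ℝ] ℝ) (f : E → ℝ) (y : E) : E :=
  (flatCLM (η y)).inverse (fderiv ℝ f y)

/-- A smooth symplectic form on the subset `U` of `E`. -/
structure IsSymplecticOn (η : E → E [⋀^Fin 2]→L[ℝ] ℝ) (U : Set E) : Prop where
  isOpen : IsOpen U
  smooth : ContDiffOn ℝ ∞ η U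
  closed : ∀ y ∈ U, extDeriv η y = 0
  nondegenerate : ∀ y ∈ U, ∀ u : E, (∀ v : E, η y ![u, v] = 0) → u = 0

variable {η : E → E [⋀^Fin 2]→L[ℝ] ℝ} {U : Set E} {f : E → ℝ}

theorem hamField_eq_zero {y : E} (hy : y ∉ tsupport f) : hamField η f y = 0 := by
  have : fderiv ℝ f y = 0 :=
    image_eq_zero_of_notMem_tsupport fun h => hy (tsupport_fderiv_subset ℝ h)
  rw [hamField, this, map_zero]

theorem IsSymplecticOn.hamField_spec (hη : IsSymplecticOn η U) {y : E} (hy : y ∈ U) (v : E) :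
    η y ![hamField η f y, v] = fderiv ℝ f y v := by
  obtain ⟨e, he⟩ := isInvertible_flatCLM (hη.nondegenerate y hy)
  rw [← flatCLM_apply, hamField, ← he, ContinuousLinearMap.inverse_equiv]
  simp

/-- On the support of `f` inversion of an invertible operator is smooth; off it the field vanishes
locally, so the behaviour of `η` outside `U` is irrelevant. -/
theorem IsSymplecticOn.contDiff_hamField (hη : IsSymplecticOn η U) (hf : ContDiff ℝ ∞ f)
    (hU : tsupport f ⊆ U) : ContDiff ℝ ∞ (hamField η f) := by
  rw [contDiff_iff_contDiffAt]
  intro y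
  by_cases hy : y ∈ tsupport f
  · have hyU := hU hy
    have h1 : ContDiffAt ℝ ∞ (fun y => flatCLM (η y)) y := by
      have : ContDiffOn ℝ ∞ (fun y => flatCLM (η y)) U := by
        rw [contDiffOn_clm_apply]
        intro u
        rw [contDiffOn_clm_apply]
        intro v
        exact (ContinuousAlternatingMap.apply ℝ E ℝ ![u, v]).contDiff.comp_contDiffOn hη.smooth
      exact this.contDiffAt (hη.isOpen.mem_nhds hyU)
    have h2 : ContDiffAt ℝ ∞ (fun y => (flatCLM (η y)).inverse) y :=
      ContDiffAt.comp (g := ContinuousLinearMap.inverse) y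
        ((isInvertible_flatCLM (hη.nondegenerate y hyU)).contDiffAt_map_inverse) h1
    exact h2.clm_apply (hf.fderiv_right (m := ∞) (by simp)).contDiffAt
  · refine contDiffAt_const (c := (0 : E)) |>.congr_of_eventuallyEq ?_
    filter_upwards [(isClosed_tsupport f).isOpen_compl.mem_nhds hy] with z hz
    exact hamField_eq_zero hz

theorem hasCompactSupport_hamField (hc : HasCompactSupport f) :
    HasCompactSupport (hamField η f) :=
  HasCompactSupport.intro' hc (isClosed_tsupport f) fun _ hy => hamField_eq_zero hy

theorem IsSymplecticOn.fderiv_hamField (hη : IsSymplecticOn η U) (hU : tsupport f ⊆ U) (y : E) :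
    fderiv ℝ f y (hamField η f y) = 0 := by
  by_cases hy : y ∈ U
  · rw [← hη.hamField_spec hy]
    exact (η y).map_eq_zero_of_eq _ (i := 0) (j := 1) rfl (by decide)
  · rw [hamField_eq_zero fun h => hy (hU h), map_zero]

variable {Ψ : ℝ × E → E}

theorem IsSymplecticOn.comp_flow (hη : IsSymplecticOn η U) (hf : ContDiff ℝ ∞ f)
    (hU : tsupport f ⊆ U) (hΨ : IsFlow (hamField η f) Ψ) (z : ℝ × E) : f (Ψ z) = f z.2 := by
  have hd : ∀ s, HasDerivAt (fun s => f (Ψ (s, z.2))) 0 s := by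
    intro s
    have := ((hf.differentiable (by simp) (Ψ (s, z.2))).hasFDerivAt).comp_hasDerivAt s
      (hΨ.deriv s z.2)
    rwa [hη.fderiv_hamField hU] at this
  have := is_const_of_deriv_eq_zero (fun s => (hd s).differentiableAt) (fun s => (hd s).deriv) z.1 0
  simpa [hΨ.zero] using this

/-- A point that lands outside the support of `f` is at a zero of the field, hence is fixed and
never moved. -/
theorem flow_mem (hf : ContDiff ℝ ∞ f) (hc : HasCompactSupport f) (hη : IsSymplecticOn η U)
    (hU : tsupport f ⊆ U) (hΨ : IsFlow (hamField η f) Ψ) {V : Set E} (hV : tsupport f ⊆ V)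
    (s : ℝ) {y : E} (hy : y ∈ V) : Ψ (s, y) ∈ V := by
  obtain ⟨L, hL, -⟩ := exists_lipschitzWith_of_hasCompactSupport (hη.contDiff_hamField hf hU)
    (hasCompactSupport_hamField hc)
  by_cases h : Ψ (s, y) ∈ tsupport f
  · exact hV h
  · have h1 := hΨ.fixed hL (hamField_eq_zero (η := η) h) (-s)
    rw [← hΨ.add hL, neg_add_cancel, hΨ.zero] at h1
    rwa [← h1]

theorem IsFlow.fderiv_one_zero {Y : E → E} (hΨ : IsFlow Y Ψ) (hs : ContDiff ℝ ∞ Ψ) (z : ℝ × E) :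
    fderiv ℝ Ψ z (1, 0) = Y (Ψ z) := by
  have h1 : HasDerivAt (fun s => Ψ (s, z.2)) (fderiv ℝ Ψ z (1, 0)) z.1 :=
    HasFDerivAt.comp_hasDerivAt (f := fun s : ℝ => (s, z.2)) (l := Ψ) z.1
      (hs.differentiable (by simp) z).hasFDerivAt
      ((hasDerivAt_id z.1).prodMk (hasDerivAt_const z.1 z.2))
  exact h1.unique (hΨ.deriv z.1 z.2)

theorem two_le_infty : minSmoothness ℝ 2 ≤ (∞ : WithTop ℕ∞) := by
  rw [minSmoothness_of_isRCLikeNormedField]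
  exact WithTop.coe_le_coe.2 le_top

/-- Hamiltonian flows preserve the symplectic form. -/
theorem IsSymplecticOn.flow_preserves (hη : IsSymplecticOn η U) (hf : ContDiff ℝ ∞ f)
    (hc : HasCompactSupport f) (hU : tsupport f ⊆ U) (hΨ : IsFlow (hamField η f) Ψ)
    (hs : ContDiff ℝ ∞ Ψ) (s : ℝ) {y : E} (hy : y ∈ U) (v w : E) :
    η (Ψ (s, y)) ![fderiv ℝ Ψ (s, y) (0, v), fderiv ℝ Ψ (s, y) (0, w)] = η y ![v, w] := by
  -- Pulling `η` back to space-time by the whole flow turns the claim into closedness of one form: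
  -- `dζ` evaluated on the time direction and two space directions.
  set ζ : ℝ × E → (ℝ × E) [⋀^Fin 2]→L[ℝ] ℝ :=
    fun z => (η (Ψ z)).compContinuousLinearMap (fderiv ℝ Ψ z) with hζ
  have hζ_apply : ∀ z a b, ζ z ![a, b] = η (Ψ z) ![fderiv ℝ Ψ z a, fderiv ℝ Ψ z b] := by
    intro z a b
    simp only [hζ, ContinuousAlternatingMap.compContinuousLinearMap_apply]
    congr 1
    ext i
    fin_cases i <;> rfl
  have hΨU : ∀ z : ℝ × E, z.2 ∈ U → Ψ z ∈ U := fun z hz => flow_mem hf hc hη hU hΨ hU z.1 hz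
  have hηd : ∀ z : ℝ × E, z.2 ∈ U → DifferentiableAt ℝ η (Ψ z) := fun z hz =>
    (hη.smooth.contDiffAt (hη.isOpen.mem_nhds (hΨU z hz))).differentiableAt (by simp)
  have hdiff : ∀ z : ℝ × E, z.2 ∈ U → DifferentiableAt ℝ ζ z := by
    intro z hz
    have h1 : DifferentiableAt ℝ (fun z => η (Ψ z)) z :=
      DifferentiableAt.comp (g := η) z (hηd z hz) (hs.differentiable (by simp) z)
    have h2 : DifferentiableAt ℝ (fderiv ℝ Ψ) z :=
      (hs.fderiv_right (m := ∞) (by simp)).differentiable (by simp) z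
    exact h1.continuousAlternatingMapCompContinuousLinearMap h2
  -- The time direction is mapped to the Hamiltonian field and `f` is invariant under the flow, so
  -- this contraction does not depend on time.
  have h10 : ∀ z : ℝ × E, z.2 ∈ U → ∀ w, ζ z ![(1, 0), (0, w)] = fderiv ℝ f z.2 w := by
    intro z hz w
    rw [hζ_apply, hΨ.fderiv_one_zero hs, hη.hamField_spec (hΨU z hz)]
    have h1 : HasFDerivAt (fun z => f (Ψ z)) ((fderiv ℝ f (Ψ z)).comp (fderiv ℝ Ψ z)) z :=
      HasFDerivAt.comp (g := f) z (hf.differentiable (by simp) (Ψ z)).hasFDerivAt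
        (hs.differentiable (by simp) z).hasFDerivAt
    have h2 : HasFDerivAt (fun z : ℝ × E => f z.2)
        ((fderiv ℝ f z.2).comp (ContinuousLinearMap.snd ℝ ℝ E)) z :=
      HasFDerivAt.comp (g := f) z (hf.differentiable (by simp) z.2).hasFDerivAt hasFDerivAt_snd
    have h3 : (fun z => f (Ψ z)) = fun z : ℝ × E => f z.2 := funext (hη.comp_flow hf hU hΨ)
    rw [h3] at h1
    exact congrArg (fun A : ℝ × E →L[ℝ] ℝ => A (0, w)) (h1.unique h2)
  have hmix : ∀ z : ℝ × E, z.2 ∈ U → ∀ v w,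
      fderiv ℝ (fun z => ζ z ![(1, 0), (0, w)]) z (0, v) = fderiv ℝ (fderiv ℝ f) z.2 v w := by
    intro z hz v w
    have h1 : (fun z => ζ z ![(1, 0), (0, w)]) =ᶠ[nhds z] fun z => fderiv ℝ f z.2 w := by
      filter_upwards [continuous_snd.continuousAt.preimage_mem_nhds (hη.isOpen.mem_nhds hz)]
        with z' hz'
      exact h10 z' hz' w
    have hD : DifferentiableAt ℝ (fderiv ℝ f) z.2 :=
      (hf.fderiv_right (m := ∞) (by simp)).differentiable (by simp) _
    have h2 : HasFDerivAt (fun z : ℝ × E => fderiv ℝ f z.2 w)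
        (((ContinuousLinearMap.apply ℝ ℝ w).comp (fderiv ℝ (fderiv ℝ f) z.2)).comp
          (ContinuousLinearMap.snd ℝ ℝ E)) z :=
      HasFDerivAt.comp (g := fun y => fderiv ℝ f y w) z
        ((ContinuousLinearMap.apply ℝ ℝ w).hasFDerivAt.comp z.2 hD.hasFDerivAt) hasFDerivAt_snd
    rw [h1.fderiv_eq, h2.fderiv]
    rfl
  have hder : ∀ s : ℝ, HasDerivAt (fun s : ℝ => ζ (s, y) ![(0, v), (0, w)]) 0 s := by
    intro s
    have hz : ((s, y) : ℝ × E).2 ∈ U := hy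
    have h0 : extDeriv ζ (s, y) = 0 := by
      rw [hζ, extDeriv_pullback (r := ∞) (hηd _ hz) hs.contDiffAt two_le_infty,
        hη.closed _ (hΨU _ hz)]
      rfl
    -- Of the three terms, the two mixed ones are second derivatives of `f` and cancel by symmetry;
    -- what remains is the time derivative of `ζ` on `v`, `w`.
    have h1 := extDeriv_apply (hdiff (s, y) hz) ![(1, 0), (0, v), (0, w)]
    have r0 : (0 : Fin 3).removeNth ![((1 : ℝ), (0 : E)), (0, v), (0, w)] = ![(0, v), (0, w)] := by
      ext i <;> fin_cases i <;> rfl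
    have r1 : (1 : Fin 3).removeNth ![((1 : ℝ), (0 : E)), (0, v), (0, w)] = ![(1, 0), (0, w)] := by
      ext i <;> fin_cases i <;> rfl
    have r2 : (2 : Fin 3).removeNth ![((1 : ℝ), (0 : E)), (0, v), (0, w)] = ![(1, 0), (0, v)] := by
      ext i <;> fin_cases i <;> rfl
    rw [h0, Fin.sum_univ_three, r0, r1, r2] at h1
    have hsymm : fderiv ℝ (fderiv ℝ f) y v w = fderiv ℝ (fderiv ℝ f) y w v :=
      (hf.contDiffAt.isSymmSndFDerivAt two_le_infty) v w
    simp [hmix _ hz, hsymm] at h1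
    have h2 : HasDerivAt (fun s : ℝ => ζ (s, y) ![(0, v), (0, w)])
        (fderiv ℝ (fun z => ζ z ![(0, v), (0, w)]) (s, y) (1, 0)) s :=
      HasFDerivAt.comp_hasDerivAt (f := fun s : ℝ => (s, y))
        (l := fun z => ζ z ![(0, v), (0, w)]) s
        ((hdiff (s, y) hz).continuousAlternatingMap_apply_const _).hasFDerivAt
        ((hasDerivAt_id s).prodMk (hasDerivAt_const s y))
    rwa [← h1] at h2
  have hconst := is_const_of_deriv_eq_zero (fun s => (hder s).differentiableAt)
    (fun s => (hder s).deriv) s 0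
  have hid : ∀ u, fderiv ℝ Ψ (0, y) (0, u) = u := by
    intro u
    have h1 : HasFDerivAt (fun x => Ψ (0, x))
        ((fderiv ℝ Ψ (0, y)).comp (ContinuousLinearMap.inr ℝ ℝ E)) y :=
      HasFDerivAt.comp (g := Ψ) y (hs.differentiable (by simp) (0, y)).hasFDerivAt
        (hasFDerivAt_prodMk_right 0 y)
    simp only [hΨ.zero] at h1
    exact congrArg (fun A : E →L[ℝ] E => A u) (h1.unique (hasFDerivAt_id y))
  simp only [hζ_apply, hid, hΨ.zero] at hconst
  exact hconst

end LocalSymplectic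

/-! ### Carrying functions and flows from a chart to the manifold. -/

section Transplant

variable {E : Type*} [NormedAddCommGroup E] [NormedSpace ℝ E] [FiniteDimensional ℝ E]
  {M : Type*} [TopologicalSpace M] [ChartedSpace E M]

/-- The symplectic form at `x` as a function of two vectors of the model space. -/
def formAt (Ω : SymplecticForm E M) (x : M) (u v : E) : ℝ :=
  Ω.form x ![(u : TangentSpace 𝓘(ℝ, E) x), v]

theorem formAt_add_left (Ω : SymplecticForm E M) (x : M) (u u' v : E) :
    formAt Ω x (u + u') v = formAt Ω x u v + formAt Ω x u' v :=
  LinearMap.congr_fun ((flat (Ω.form x)).map_add u u') v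

theorem formAt_smul_left (Ω : SymplecticForm E M) (x : M) (r : ℝ) (u v : E) :
    formAt Ω x (r • u) v = r * formAt Ω x u v :=
  LinearMap.congr_fun ((flat (Ω.form x)).map_smul r u) v

/-- The derivative of a map of manifolds, as a linear map of the model space. -/
def modelDeriv (E : Type*) [NormedAddCommGroup E] [NormedSpace ℝ E] {N N' : Type*} [TopologicalSpace N] [ChartedSpace E N]
    [TopologicalSpace N'] [ChartedSpace E N'] (F : N → N') (x : N) : E →L[ℝ] E :=
  mfderiv 𝓘(ℝ, E) 𝓘(ℝ, E) F x

/-- The differential of a function, as a linear form on the model space. -/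
def modelDiff (E : Type*) [NormedAddCommGroup E] [NormedSpace ℝ E] {M : Type*}
    [TopologicalSpace M] [ChartedSpace E M] (h : M → ℝ) (x : M) : E →L[ℝ] ℝ :=
  mfderiv 𝓘(ℝ, E) 𝓘(ℝ, ℝ) h x

/-- The symplectic gradient, as a vector of the model space. -/
def modelGrad (E : Type*) [NormedAddCommGroup E] [NormedSpace ℝ E] [FiniteDimensional ℝ E]
    {M : Type*} [TopologicalSpace M] [ChartedSpace E M] (Ω : SymplecticForm E M) (h : M → ℝ) (x : M) : E :=
  sympGrad Ω h x

theorem formAt_modelGrad (Ω : SymplecticForm E M) (h : M → ℝ) (x : M) (v : E) :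
    formAt Ω x (modelGrad E Ω h x) v = modelDiff E h x v :=
  sympGrad_spec Ω h x v

theorem eq_of_formAt_eq {Ω : SymplecticForm E M} {x : M} {u u' : E}
    (h : ∀ v : E, formAt Ω x u v = formAt Ω x u' v) : u = u' := by
  have h1 : u + (-1 : ℝ) • u' = 0 := by
    refine Ω.nondegenerate x _ fun (v : E) => ?_
    change formAt Ω x (u + (-1 : ℝ) • u') v = 0
    rw [formAt_add_left, formAt_smul_left, h]
    ring
  rwa [neg_one_smul, ← sub_eq_add_neg, sub_eq_zero] at h1

theorem modelGrad_eq_of_forall {Ω : SymplecticForm E M} {h : M → ℝ} {x : M} {u : E}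
    (hu : ∀ v : E, formAt Ω x u v = modelDiff E h x v) : modelGrad E Ω h x = u :=
  eq_of_formAt_eq fun v => by rw [formAt_modelGrad, hu]

/-- `HasMFDerivAt` with the derivative given as a linear map of the model space. -/
def HasModelDerivAt {N N' : Type*} [TopologicalSpace N] [ChartedSpace E N]
    [TopologicalSpace N'] [ChartedSpace E N'] (F : N → N') (A : E →L[ℝ] E) (x : N) : Prop :=
  HasMFDerivAt 𝓘(ℝ, E) 𝓘(ℝ, E) F x A

/-- The curve `γ` has velocity `v` at time `t`, within the set `S` of times. -/
def HasVelocityWithinAt (γ : ℝ → M) (v : E) (S : Set ℝ) (t : ℝ) : Prop :=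
  HasMFDerivWithinAt 𝓘(ℝ, ℝ) 𝓘(ℝ, E) γ S t ((1 : ℝ →L[ℝ] ℝ).smulRight v)

theorem hasVelocityWithinAt_of_eq {γ : ℝ → M} {A : ℝ →L[ℝ] E} {v : E} {S : Set ℝ} {t : ℝ}
    (h : HasMFDerivWithinAt 𝓘(ℝ, ℝ) 𝓘(ℝ, E) γ S t A) (hA : A 1 = v) :
    HasVelocityWithinAt γ v S t := by
  have e : (1 : ℝ →L[ℝ] ℝ).smulRight v = A := by
    ext
    simp [hA]
  exact (congrArg (fun B : ℝ →L[ℝ] E => HasMFDerivWithinAt 𝓘(ℝ, ℝ) 𝓘(ℝ, E) γ S t B) e).mpr h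

theorem HasModelDerivAt.comp {N N' N'' : Type*} [TopologicalSpace N] [ChartedSpace E N]
    [TopologicalSpace N'] [ChartedSpace E N'] [TopologicalSpace N''] [ChartedSpace E N'']
    {F : N → N'} {G : N' → N''} {A B : E →L[ℝ] E} {x : N}
    (hG : HasModelDerivAt G B (F x)) (hF : HasModelDerivAt F A x) :
    HasModelDerivAt (fun x => G (F x)) (B.comp A) x :=
  HasMFDerivAt.comp (g := G) (f := F) x hG hF

theorem HasModelDerivAt.modelDeriv_eq {F : M → M} {x : M} {A : E →L[ℝ] E}
    (h : HasModelDerivAt F A x) : modelDeriv E F x = A := HasMFDerivAt.mfderiv h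

theorem HasModelDerivAt.congr {F G : M → M} {x : M} {A : E →L[ℝ] E}
    (h : HasModelDerivAt F A x) (hG : G =ᶠ[nhds x] F) : HasModelDerivAt G A x :=
  HasMFDerivAt.congr_of_eventuallyEq h hG

theorem HasModelDerivAt.comp_velocity {N : Type*} [TopologicalSpace N] [ChartedSpace E N]
    {F : N → M} {A : E →L[ℝ] E} {γ : ℝ → N} {v : E} {S : Set ℝ} {t : ℝ}
    (hF : HasModelDerivAt F A (γ t)) (hγ : HasVelocityWithinAt γ v S t) :
    HasVelocityWithinAt (fun s => F (γ s)) (A v) S t :=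
  hasVelocityWithinAt_of_eq (A := A.comp ((1 : ℝ →L[ℝ] ℝ).smulRight v))
    (HasMFDerivAt.comp_hasMFDerivWithinAt (g := F) (f := γ) t hF hγ) (by simp)

theorem modelDiff_eq {h : M → ℝ} {x : M} {A : E →L[ℝ] ℝ}
    (hA : HasMFDerivAt 𝓘(ℝ, E) 𝓘(ℝ, ℝ) h x A) : modelDiff E h x = A := hA.mfderiv

/-- A global smooth flow of the symplectic gradient of `g`, by symplectomorphisms
that preserve `g`. -/
structure IsHamFlow (Ω : SymplecticForm E M) (g : M → ℝ) (ψ : ℝ × M → M) : Prop where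
  smooth : ContMDiff (𝓘(ℝ, ℝ).prod 𝓘(ℝ, E)) 𝓘(ℝ, E) ∞ ψ
  zero : ∀ x, ψ (0, x) = x
  neg : ∀ s x, ψ (s, ψ (-s, x)) = x
  velocity : ∀ s x, HasVelocityWithinAt (fun s => ψ (s, x)) (modelGrad E Ω g (ψ (s, x))) univ s
  comp : ∀ s x, g (ψ (s, x)) = g x
  symplectic : ∀ s x (u v : E), formAt Ω (ψ (s, x)) (modelDeriv E (fun x => ψ (s, x)) x u)
    (modelDeriv E (fun x => ψ (s, x)) x v) = formAt Ω x u v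

open Classical in
/-- The function `f` on the model space, transplanted to the domain of the chart `c` and
extended by zero. -/
def chartFun (c : OpenPartialHomeomorph M E) (f : E → ℝ) (x : M) : ℝ :=
  if x ∈ c.source then f (c x) else 0

open Classical in
/-- The family `Ψ` of maps of the model space, transplanted to the domain of the chart `c` and
extended by the identity. -/
def chartFlow (c : OpenPartialHomeomorph M E) (Ψ : ℝ × E → E) (z : ℝ × M) : M :=
  if z.2 ∈ c.source then c.symm (Ψ (z.1, c z.2)) else z.2

variable {c : OpenPartialHomeomorph M E} {f : E → ℝ} {Ψ : ℝ × E → E}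

theorem chartFun_of_mem {x : M} (hx : x ∈ c.source) : chartFun c f x = f (c x) := if_pos hx

theorem chartFlow_of_mem {s : ℝ} {x : M} (hx : x ∈ c.source) :
    chartFlow c Ψ (s, x) = c.symm (Ψ (s, c x)) := if_pos hx

theorem isCompact_symm_image_tsupport (hcs : HasCompactSupport f) (hU : tsupport f ⊆ c.target) :
    IsCompact (c.symm '' tsupport f) :=
  IsCompact.image_of_continuousOn hcs (c.continuousOn_symm.mono hU)

theorem notMem_tsupport_of_notMem_image {x : M} (hx : x ∈ c.source)
    (h : x ∉ c.symm '' tsupport f) : c x ∉ tsupport f :=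
  fun h' => h ⟨c x, h', c.left_inv hx⟩

theorem chartFun_of_notMem_image {x : M} (h : x ∉ c.symm '' tsupport f) : chartFun c f x = 0 := by
  by_cases hx : x ∈ c.source
  · rw [chartFun_of_mem hx]
    exact image_eq_zero_of_notMem_tsupport (notMem_tsupport_of_notMem_image hx h)
  · exact if_neg hx

theorem hasCompactSupport_chartFun [T2Space M] (hcs : HasCompactSupport f)
    (hU : tsupport f ⊆ c.target) : HasCompactSupport (chartFun c f) :=
  HasCompactSupport.intro (isCompact_symm_image_tsupport hcs hU)
    fun _ hx => chartFun_of_notMem_image hx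

/-- The image of the support is compact, hence closed because `M` is Hausdorff; its complement and
the chart domain cover `M`. -/
theorem contMDiff_chartFun [T2Space M] [IsManifold 𝓘(ℝ, E) ∞ M] (hc : c ∈ atlas E M)
    (hf : ContDiff ℝ ∞ f) (hcs : HasCompactSupport f) (hU : tsupport f ⊆ c.target) :
    ContMDiff 𝓘(ℝ, E) 𝓘(ℝ, ℝ) ∞ (chartFun c f) := by
  intro x
  by_cases hx : x ∈ c.source
  · have h1 : ContMDiffAt 𝓘(ℝ, E) 𝓘(ℝ, E) ∞ c x :=
      contMDiffAt_of_mem_maximalAtlas (IsManifold.subset_maximalAtlas hc) hx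
    refine (hf.contMDiff.contMDiffAt.comp x h1).congr_of_eventuallyEq ?_
    filter_upwards [c.open_source.mem_nhds hx] with y hy
    exact chartFun_of_mem hy
  · have hx' : x ∈ (c.symm '' tsupport f)ᶜ := by
      rintro ⟨y, hy, rfl⟩
      exact hx (c.map_target (hU hy))
    refine (contMDiffAt_const (c := (0 : ℝ))).congr_of_eventuallyEq ?_
    filter_upwards [(isCompact_symm_image_tsupport hcs hU).isClosed.isOpen_compl.mem_nhds hx']
      with y hy
    exact chartFun_of_notMem_image hy

variable {Ω : SymplecticForm E M}

theorem chartExpr_apply (c : OpenPartialHomeomorph M E) (y u v : E) :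
    chartExpr Ω.form c y ![u, v] =
      formAt Ω (c.symm y) (modelDeriv E c.symm y u) (modelDeriv E c.symm y v) := by
  change Ω.form (c.symm y) (fun i => modelDeriv E c.symm y (![u, v] i)) = _
  unfold formAt
  congr 1
  ext i
  fin_cases i <;> rfl

section

variable [IsManifold 𝓘(ℝ, E) ∞ M]

theorem mdifferentiable_chart_of_mem_atlas (hc : c ∈ atlas E M) :
    c.MDifferentiable 𝓘(ℝ, E) 𝓘(ℝ, E) := by
  have : IsManifold 𝓘(ℝ, E) 1 M := IsManifold.of_le (n := ∞) (by simp)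
  exact mdifferentiable_of_mem_atlas hc

theorem hasModelDerivAt_chart (hc : c ∈ atlas E M) {x : M} (hx : x ∈ c.source) :
    HasModelDerivAt c (modelDeriv E c x) x :=
  ((mdifferentiable_chart_of_mem_atlas hc).mdifferentiableAt hx).hasMFDerivAt

theorem hasModelDerivAt_chart_symm (hc : c ∈ atlas E M) {y : E} (hy : y ∈ c.target) :
    HasModelDerivAt c.symm (modelDeriv E c.symm y) y :=
  ((mdifferentiable_chart_of_mem_atlas hc).mdifferentiableAt_symm hy).hasMFDerivAt

theorem modelDeriv_symm_apply (hc : c ∈ atlas E M) {x : M} (hx : x ∈ c.source) (v : E) :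
    modelDeriv E c.symm (c x) (modelDeriv E c x v) = v :=
  congrArg (fun A : E →L[ℝ] E => A v)
    ((mdifferentiable_chart_of_mem_atlas hc).symm_comp_deriv hx)

theorem modelDeriv_apply_symm (hc : c ∈ atlas E M) {y : E} (hy : y ∈ c.target) (v : E) :
    modelDeriv E c (c.symm y) (modelDeriv E c.symm y v) = v :=
  congrArg (fun A : E →L[ℝ] E => A v)
    ((mdifferentiable_chart_of_mem_atlas hc).comp_symm_deriv hy)

theorem modelDeriv_symm_apply' (hc : c ∈ atlas E M) {y : E} (hy : y ∈ c.target) (v : E) :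
    modelDeriv E c.symm y (modelDeriv E c (c.symm y) v) = v := by
  have := modelDeriv_symm_apply hc (c.map_target hy) v
  rwa [c.right_inv hy] at this

theorem isSymplecticOn_chartExpr (Ω : SymplecticForm E M) (hc : c ∈ atlas E M) :
    IsSymplecticOn (chartExpr Ω.form c) c.target where
  isOpen := c.open_target
  smooth := Ω.smooth c hc
  closed := Ω.closed c hc
  nondegenerate := by
    intro y hy u hu
    have h1 : modelDeriv E c.symm y u = 0 := by
      refine Ω.nondegenerate (c.symm y) _ fun (v : E) => ?_
      have h2 := hu (modelDeriv E c (c.symm y) v)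
      rw [chartExpr_apply (Ω := Ω), modelDeriv_symm_apply' hc hy] at h2
      exact h2
    rw [← modelDeriv_apply_symm hc hy u, h1, map_zero]

theorem modelGrad_chartFun (hc : c ∈ atlas E M) (hf : ContDiff ℝ ∞ f) {y : E}
    (hy : y ∈ c.target) : modelGrad E Ω (chartFun c f) (c.symm y) =
      modelDeriv E c.symm y (hamField (chartExpr Ω.form c) f y) := by
  apply modelGrad_eq_of_forall
  intro v
  have h1 : formAt Ω (c.symm y) (modelDeriv E c.symm y (hamField (chartExpr Ω.form c) f y)) v =
      fderiv ℝ f y (modelDeriv E c (c.symm y) v) := by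
    rw [← (isSymplecticOn_chartExpr Ω hc).hamField_spec hy, chartExpr_apply,
      modelDeriv_symm_apply' hc hy]
  have h4 : HasMFDerivAt 𝓘(ℝ, E) 𝓘(ℝ, ℝ) (fun x => f (c x)) (c.symm y)
      ((fderiv ℝ f (c (c.symm y))).comp (modelDeriv E c (c.symm y))) :=
    HasMFDerivAt.comp (g := f) (c.symm y)
      (hf.differentiable (by simp) _).hasFDerivAt.hasMFDerivAt
      (hasModelDerivAt_chart hc (c.map_target hy))
  have h5 : chartFun c f =ᶠ[nhds (c.symm y)] fun x => f (c x) := by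
    filter_upwards [c.open_source.mem_nhds (c.map_target hy)] with x hx
    exact chartFun_of_mem hx
  rw [h1, modelDiff_eq (h4.congr_of_eventuallyEq h5), c.right_inv hy]
  rfl

end

theorem modelGrad_chartFun_of_notMem [T2Space M] (hcs : HasCompactSupport f)
    (hU : tsupport f ⊆ c.target) {x : M} (hx : x ∉ c.symm '' tsupport f) :
    modelGrad E Ω (chartFun c f) x = 0 := by
  apply modelGrad_eq_of_forall
  intro v
  have h1 : chartFun c f =ᶠ[nhds x] fun _ => 0 := by
    filter_upwards [(isCompact_symm_image_tsupport hcs hU).isClosed.isOpen_compl.mem_nhds hx]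
      with y hy
    exact chartFun_of_notMem_image hy
  rw [modelDiff_eq ((hasMFDerivAt_const (I := 𝓘(ℝ, E)) (I' := 𝓘(ℝ, ℝ)) (0 : ℝ)
    x).congr_of_eventuallyEq h1)]
  have := formAt_smul_left Ω x 0 0 v
  rwa [zero_smul, zero_mul] at this

/-- The pushforward to `M` of the flow of `f` in the chart `c` is the flow of `chartFun c f`. -/
theorem isHamFlow_chartFlow [T2Space M] [IsManifold 𝓘(ℝ, E) ∞ M] (hc : c ∈ atlas E M)
    (hf : ContDiff ℝ ∞ f) (hcs : HasCompactSupport f) (hU : tsupport f ⊆ c.target)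
    (hΨ : IsFlow (hamField (chartExpr Ω.form c) f) Ψ) :
    IsHamFlow Ω (chartFun c f) (chartFlow c Ψ) := by
  have hη := isSymplecticOn_chartExpr Ω hc
  have hY := hη.contDiff_hamField hf hU
  have hYc := hasCompactSupport_hamField (η := chartExpr Ω.form c) hcs
  have hs := hΨ.contDiff hY hYc
  obtain ⟨L, hL, -⟩ := exists_lipschitzWith_of_hasCompactSupport hY hYc
  have hmem : ∀ s y, y ∈ c.target → Ψ (s, y) ∈ c.target := fun s y hy =>
    flow_mem hf hcs hη hU hΨ hU s hy
  have hclosed := (isCompact_symm_image_tsupport hcs hU).isClosed.isOpen_compl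
  have hsub : c.symm '' tsupport f ⊆ c.source := by
    rintro _ ⟨y, hy, rfl⟩
    exact c.map_target (hU hy)
  have hfix : ∀ s x, x ∉ c.symm '' tsupport f → chartFlow c Ψ (s, x) = x := by
    intro s x hx
    by_cases hxs : x ∈ c.source
    · rw [chartFlow_of_mem hxs,
        hΨ.fixed hL (hamField_eq_zero (notMem_tsupport_of_notMem_image hxs hx)), c.left_inv hxs]
    · exact if_neg hxs
  refine ⟨?_, ?_, ?_, ?_, ?_, ?_⟩
  · rintro ⟨s, x⟩
    by_cases hx : x ∈ c.source
    · have h1 : ContMDiffAt (𝓘(ℝ, ℝ).prod 𝓘(ℝ, E)) (𝓘(ℝ, ℝ).prod 𝓘(ℝ, E)) ∞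
          (fun z : ℝ × M => (z.1, c z.2)) (s, x) :=
        contMDiffAt_fst.prodMk
          (ContMDiffAt.comp (g := c) (s, x) (contMDiffAt_of_mem_maximalAtlas
            (IsManifold.subset_maximalAtlas hc) hx) contMDiffAt_snd)
      have h2 : ContMDiffAt (𝓘(ℝ, ℝ).prod 𝓘(ℝ, E)) 𝓘(ℝ, E) ∞ Ψ (s, c x) := by
        have h := hs.contMDiff.contMDiffAt (x := (s, c x))
        rwa [modelWithCornersSelf_prod, ← chartedSpaceSelf_prod] at h
      have h3 : ContMDiffAt 𝓘(ℝ, E) 𝓘(ℝ, E) ∞ c.symm (Ψ (s, c x)) :=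
        contMDiffAt_symm_of_mem_maximalAtlas (IsManifold.subset_maximalAtlas hc)
          (hmem s _ (c.map_source hx))
      have h4 : ContMDiffAt (𝓘(ℝ, ℝ).prod 𝓘(ℝ, E)) 𝓘(ℝ, E) ∞
          (fun z : ℝ × M => c.symm (Ψ (z.1, c z.2))) (s, x) :=
        ContMDiffAt.comp (g := c.symm) (f := fun z : ℝ × M => Ψ (z.1, c z.2)) (s, x) h3
          (ContMDiffAt.comp (g := Ψ) (f := fun z : ℝ × M => (z.1, c z.2)) (s, x) h2 h1)
      refine h4.congr_of_eventuallyEq ?_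
      filter_upwards [continuous_snd.continuousAt.preimage_mem_nhds
        (c.open_source.mem_nhds hx)] with z hz
      exact chartFlow_of_mem hz
    · refine contMDiffAt_snd.congr_of_eventuallyEq ?_
      filter_upwards [continuous_snd.continuousAt.preimage_mem_nhds
        (hclosed.mem_nhds fun h => hx (hsub h))] with z hz
      exact hfix z.1 z.2 hz
  · intro x
    by_cases hx : x ∈ c.source
    · rw [chartFlow_of_mem hx, hΨ.zero, c.left_inv hx]
    · exact if_neg hx
  · intro s x
    by_cases hx : x ∈ c.source
    · have h1 := hmem (-s) _ (c.map_source hx)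
      rw [chartFlow_of_mem hx, chartFlow_of_mem (c.map_target h1), c.right_inv h1,
        ← hΨ.add hL, add_neg_cancel, hΨ.zero, c.left_inv hx]
    · have hx' : x ∉ c.symm '' tsupport f := fun h => hx (hsub h)
      rw [hfix _ _ hx', hfix _ _ hx']
  · intro s x
    by_cases hx : x ∈ c.source
    · have h1 : HasVelocityWithinAt (fun s => Ψ (s, c x))
          (hamField (chartExpr Ω.form c) f (Ψ (s, c x))) univ s :=
        (hΨ.deriv s (c x)).hasFDerivAt.hasMFDerivAt.hasMFDerivWithinAt
      have h2 : (fun s => chartFlow c Ψ (s, x)) = fun s => c.symm (Ψ (s, c x)) :=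
        funext fun s => chartFlow_of_mem hx
      rw [h2, chartFlow_of_mem hx, modelGrad_chartFun hc hf (hmem s _ (c.map_source hx))]
      exact (hasModelDerivAt_chart_symm hc (hmem s _ (c.map_source hx))).comp_velocity h1
    · have hx' : x ∉ c.symm '' tsupport f := fun h => hx (hsub h)
      have h2 : (fun s => chartFlow c Ψ (s, x)) = fun _ => x := funext fun s => hfix s x hx'
      rw [h2, hfix s x hx', modelGrad_chartFun_of_notMem hcs hU hx']
      exact hasVelocityWithinAt_of_eq (A := 0) (hasMFDerivWithinAt_const x univ s) rfl
  · intro s x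
    by_cases hx : x ∈ c.source
    · have h1 := hmem s _ (c.map_source hx)
      rw [chartFlow_of_mem hx, chartFun_of_mem (c.map_target h1), c.right_inv h1,
        hη.comp_flow hf hU hΨ, chartFun_of_mem hx]
    · rw [hfix s x fun h => hx (hsub h)]
  · intro s x u v
    by_cases hx : x ∈ c.source
    · have hy := c.map_source hx
      have h1 : HasFDerivAt (fun y => Ψ (s, y))
          ((fderiv ℝ Ψ (s, c x)).comp (ContinuousLinearMap.inr ℝ ℝ E)) (c x) :=
        HasFDerivAt.comp (g := Ψ) (c x) (hs.differentiable (by simp) (s, c x)).hasFDerivAt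
          (hasFDerivAt_prodMk_right s (c x))
      have h2 := HasModelDerivAt.comp (F := fun x => Ψ (s, c x))
        (hasModelDerivAt_chart_symm hc (hmem s _ hy)) (HasModelDerivAt.comp (G := fun y => Ψ (s, y)) h1.hasMFDerivAt (hasModelDerivAt_chart hc hx))
      have h3 : (fun x => chartFlow c Ψ (s, x)) =ᶠ[nhds x] fun x => c.symm (Ψ (s, c x)) := by
        filter_upwards [c.open_source.mem_nhds hx] with x' hx'
        exact chartFlow_of_mem hx'
      rw [(h2.congr h3).modelDeriv_eq, chartFlow_of_mem hx]
      simp only [ContinuousLinearMap.comp_apply, ContinuousLinearMap.inr_apply]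
      rw [← chartExpr_apply (Ω := Ω), hη.flow_preserves hf hcs hU hΨ hs s hy, chartExpr_apply,
        modelDeriv_symm_apply hc hx, modelDeriv_symm_apply hc hx, c.left_inv hx]
    · have hx' : x ∉ c.symm '' tsupport f := fun h => hx (hsub h)
      have h3 : (fun x => chartFlow c Ψ (s, x)) =ᶠ[nhds x] id := by
        filter_upwards [hclosed.mem_nhds hx'] with y hy
        exact hfix s y hy
      have h4 : HasModelDerivAt (id : M → M) (ContinuousLinearMap.id ℝ E) x := hasMFDerivAt_id x
      rw [(h4.congr h3).modelDeriv_eq, hfix s x hx']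
      rfl

end Transplant

/-! ### Calculus of a global Hamiltonian flow on the manifold. -/

section HamiltonianFlow

variable {E : Type*} [NormedAddCommGroup E] [NormedSpace ℝ E] [FiniteDimensional ℝ E]
  {M : Type*} [TopologicalSpace M] [ChartedSpace E M]
  {Ω : SymplecticForm E M} {g : M → ℝ} {ψ : ℝ × M → M}

theorem HasVelocityWithinAt.eq {γ : ℝ → M} {v w : E} {S : Set ℝ} {t : ℝ}
    (hS : UniqueDiffWithinAt ℝ S t) (hv : HasVelocityWithinAt γ v S t)
    (hw : HasVelocityWithinAt γ w S t) : v = w := by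
  have h : (1 : ℝ →L[ℝ] ℝ).smulRight v = (1 : ℝ →L[ℝ] ℝ).smulRight w :=
    UniqueMDiffWithinAt.eq (uniqueMDiffWithinAt_iff_uniqueDiffWithinAt.2 hS) hv hw
  simpa using congrArg (fun A : ℝ →L[ℝ] E => A 1) h

/-- The derivative of a map `ℝ × M → M`, as a linear map of model spaces. -/
def jointDeriv (E : Type*) [NormedAddCommGroup E] [NormedSpace ℝ E] {M : Type*}
    [TopologicalSpace M] [ChartedSpace E M] (ψ : ℝ × M → M) (z : ℝ × M) : ℝ × E →L[ℝ] E :=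
  mfderiv (𝓘(ℝ, ℝ).prod 𝓘(ℝ, E)) 𝓘(ℝ, E) ψ z

/-- The partial derivatives of a differentiable map on `ℝ × M`. -/
theorem IsHamFlow.jointDeriv_apply (h : IsHamFlow Ω g ψ) (s : ℝ) (x : M) (r : ℝ) (v : E) :
    jointDeriv E ψ (s, x) (r, v) =
      r • modelGrad E Ω g (ψ (s, x)) + modelDeriv E (fun x => ψ (s, x)) x v := by
  have h2 : HasMFDerivAt 𝓘(ℝ, ℝ) 𝓘(ℝ, E) (fun s => ψ (s, x)) s
      ((1 : ℝ →L[ℝ] ℝ).smulRight (modelGrad E Ω g (ψ (s, x))) : ℝ →L[ℝ] E) :=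
    hasMFDerivWithinAt_univ.1 (h.velocity s x)
  have h3 : (1 : ℝ →L[ℝ] ℝ).smulRight (modelGrad E Ω g (ψ (s, x))) =
      mfderiv 𝓘(ℝ, ℝ) 𝓘(ℝ, E) (fun s => ψ (s, x)) s := h2.mfderiv.symm
  have h4 : r • modelGrad E Ω g (ψ (s, x)) =
      mfderiv 𝓘(ℝ, ℝ) 𝓘(ℝ, E) (fun s => ψ (s, x)) s r := congrArg (fun A : ℝ →L[ℝ] E => A r) h3
  rw [h4]
  exact mfderiv_prod_eq_add_apply (p := (s, x)) (v := (r, v))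
    (h.smooth.mdifferentiable (by simp) (s, x))

theorem IsHamFlow.velocity_comp (h : IsHamFlow Ω g ψ) {b : ℝ → ℝ} {b' : ℝ} {ξ : ℝ → M} {v : E}
    {S : Set ℝ} {t : ℝ} (hb : HasDerivAt b b' t) (hξ : HasVelocityWithinAt ξ v S t) :
    HasVelocityWithinAt (fun s => ψ (b s, ξ s))
      (b' • modelGrad E Ω g (ψ (b t, ξ t)) + modelDeriv E (fun x => ψ (b t, x)) (ξ t) v) S t := by
  have hd : HasMFDerivAt (𝓘(ℝ, ℝ).prod 𝓘(ℝ, E)) 𝓘(ℝ, E) ψ (b t, ξ t) _ :=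
    (h.smooth.mdifferentiable (by simp) (b t, ξ t)).hasMFDerivAt
  have hp : HasMFDerivWithinAt 𝓘(ℝ, ℝ) (𝓘(ℝ, ℝ).prod 𝓘(ℝ, E)) (fun s => (b s, ξ s)) S t _ :=
    HasMFDerivWithinAt.prodMk hb.hasFDerivAt.hasMFDerivAt.hasMFDerivWithinAt hξ
  refine hasVelocityWithinAt_of_eq (HasMFDerivAt.comp_hasMFDerivWithinAt (g := ψ) t hd hp) ?_
  rw [← h.jointDeriv_apply (b t) (ξ t) b' v]
  change jointDeriv E ψ (b t, ξ t) ((1 : ℝ) • b', (1 : ℝ) • v) = _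
  rw [one_smul, one_smul]

theorem IsHamFlow.neg' (h : IsHamFlow Ω g ψ) (s : ℝ) (x : M) : ψ (-s, ψ (s, x)) = x := by
  simpa using h.neg (-s) x

theorem modelDiff_const_mul (hg : ContMDiff 𝓘(ℝ, E) 𝓘(ℝ, ℝ) ∞ g) (k : ℝ) (x : M) :
    modelDiff E (fun y => k * g y) x = k • modelDiff E g x :=
  const_smul_mfderiv (hg.mdifferentiable (by simp) x) k

theorem modelGrad_const_mul (hg : ContMDiff 𝓘(ℝ, E) 𝓘(ℝ, ℝ) ∞ g) (k : ℝ) (x : M) :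
    modelGrad E Ω (fun y => k * g y) x = k • modelGrad E Ω g x := by
  apply modelGrad_eq_of_forall
  intro v
  rw [formAt_smul_left, formAt_modelGrad, modelDiff_const_mul hg]
  rfl

/-- Rescaling the Hamiltonian rescales the time of its flow. -/
theorem IsHamFlow.const_mul (h : IsHamFlow Ω g ψ) (hg : ContMDiff 𝓘(ℝ, E) 𝓘(ℝ, ℝ) ∞ g) (k : ℝ) :
    IsHamFlow Ω (fun y => k * g y) (fun z => ψ (k * z.1, z.2)) where
  smooth := by
    have h1 : ContMDiff (𝓘(ℝ, ℝ).prod 𝓘(ℝ, E)) 𝓘(ℝ, ℝ) ∞ (fun z : ℝ × M => k * z.1) :=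
      ContMDiff.comp (g := fun s : ℝ => k * s)
        (ContDiff.contMDiff (contDiff_const.mul contDiff_id)) contMDiff_fst
    exact h.smooth.comp (h1.prodMk contMDiff_snd)
  zero x := by simp [h.zero]
  neg s x := by simp [h.neg]
  velocity s x := by
    have h1 : HasDerivAt (fun s => k * s) k s := by simpa using (hasDerivAt_id s).const_mul k
    have h2 := h.velocity_comp (S := univ) (ξ := fun _ => x) h1
      (hasVelocityWithinAt_of_eq (A := 0) (v := 0) (hasMFDerivWithinAt_const x univ s) rfl)
    rw [map_zero, add_zero] at h2
    rw [modelGrad_const_mul hg]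
    exact h2
  comp s x := by simp [h.comp]
  symplectic s x u v := h.symplectic (k * s) x u v

/-- The generating vector field of a smooth flow is smooth. -/
theorem IsHamFlow.contMDiff_sympGrad [IsManifold 𝓘(ℝ, E) ∞ M] (h : IsHamFlow Ω g ψ) :
    ContMDiff 𝓘(ℝ, E) 𝓘(ℝ, E).tangent 1
      (fun x => (⟨x, sympGrad Ω g x⟩ : TangentBundle 𝓘(ℝ, E) M)) := by
  have : IsManifold 𝓘(ℝ, E) 1 M := IsManifold.of_le (n := ∞) (by simp)
  have : IsManifold 𝓘(ℝ, E) 2 M := IsManifold.of_le (n := ∞) (WithTop.coe_le_coe.2 le_top)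
  -- The field at `x` is the derivative of `ψ` at `(0, x)` in the direction `(1, 0)`, so regularity
  -- is inherited from the tangent map of `ψ`.
  have h1 : ContMDiff (𝓘(ℝ, ℝ).prod 𝓘(ℝ, E)).tangent 𝓘(ℝ, E).tangent 1
      (tangentMap (𝓘(ℝ, ℝ).prod 𝓘(ℝ, E)) 𝓘(ℝ, E) ψ) :=
    h.smooth.contMDiff_tangentMap (WithTop.coe_le_coe.2 le_top)
  have h2 : ContMDiff 𝓘(ℝ, E) 𝓘(ℝ, E).tangent 1
      (fun x => (⟨x, (0 : E)⟩ : TangentBundle 𝓘(ℝ, E) M)) :=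
    Bundle.contMDiff_zeroSection ℝ (TangentSpace 𝓘(ℝ, E) : M → Type _)
  have h3 : ContMDiff 𝓘(ℝ, E) (𝓘(ℝ, ℝ).tangent.prod 𝓘(ℝ, E).tangent) 1
      (fun x => ((⟨(0 : ℝ), (1 : ℝ)⟩, ⟨x, (0 : E)⟩) :
        TangentBundle 𝓘(ℝ, ℝ) ℝ × TangentBundle 𝓘(ℝ, E) M)) := contMDiff_const.prodMk h2
  have h4 := h1.comp ((contMDiff_equivTangentBundleProd_symm
    (I := 𝓘(ℝ, ℝ)) (M := ℝ) (I' := 𝓘(ℝ, E)) (M' := M) (n := 1)).comp h3)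
  refine h4.congr fun x => ?_
  have h5 := h.jointDeriv_apply 0 x 1 0
  rw [map_zero, add_zero, one_smul, h.zero] at h5
  change (⟨x, modelGrad E Ω g x⟩ : TangentBundle 𝓘(ℝ, E) M) =
    (⟨ψ (0, x), jointDeriv E ψ (0, x) ((1 : ℝ), (0 : E))⟩ :
      TangentBundle 𝓘(ℝ, E) M)
  refine Bundle.TotalSpace.ext (h.zero x).symm (heq_of_eq h5.symm)

/-- `hamFlow` follows a chosen integral curve; uniqueness for the `C^1` field `sympGrad Ω g` makes
the choice immaterial. -/
theorem IsHamFlow.hamFlow_eq [T2Space M] [IsManifold 𝓘(ℝ, E) ∞ M] (h : IsHamFlow Ω g ψ)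
    (s : ℝ) (x : M) : hamFlow Ω g s x = ψ (s, x) := by
  have : IsManifold 𝓘(ℝ, E) 1 M := IsManifold.of_le (n := ∞) (by simp)
  have h1 : IsMIntegralCurve (fun s => ψ (s, x)) (I := 𝓘(ℝ, E)) (sympGrad Ω g) := fun s =>
    hasMFDerivWithinAt_univ.1 (h.velocity s x)
  have hex : ∃ c : ℝ → M, c 0 = x ∧ IsMIntegralCurve c (I := 𝓘(ℝ, E)) (sympGrad Ω g) :=
    ⟨_, h.zero x, h1⟩
  unfold hamFlow
  rw [dif_pos hex]
  have h2 := hex.choose_spec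
  exact congrFun (isMIntegralCurve_Ioo_eq_of_contMDiff_boundaryless (t₀ := 0)
    h.contMDiff_sympGrad h2.2 h1 (h2.1.trans (h.zero x).symm)) s

/-- The Hamiltonian of the composition of a Hamiltonian isotopy with the flow of `g`. -/
theorem IsHamFlow.modelGrad_comp (h : IsHamFlow Ω g ψ) (hg : ContMDiff 𝓘(ℝ, E) 𝓘(ℝ, ℝ) ∞ g)
    {k : M → ℝ} (hk : ContMDiff 𝓘(ℝ, E) 𝓘(ℝ, ℝ) ∞ k) (r s : ℝ) (x : M) :
    modelGrad E Ω (fun y => r * g y + k (ψ (-s, y))) (ψ (s, x)) =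
      r • modelGrad E Ω g (ψ (s, x)) +
        modelDeriv E (fun x => ψ (s, x)) x (modelGrad E Ω k x) := by
  have hslice : ∀ s y, HasModelDerivAt (fun x => ψ (s, x)) (modelDeriv E (fun x => ψ (s, x)) y) y :=
    fun s y => MDifferentiableAt.hasMFDerivAt
      ((h.smooth.comp (contMDiff_const.prodMk contMDiff_id)).mdifferentiable (by simp) y)
  set z := ψ (s, x) with hz
  have hx : ψ (-s, z) = x := h.neg' s x
  set A := modelDeriv E (fun x => ψ (s, x)) x with hA
  set B := modelDeriv E (fun x => ψ (-s, x)) z with hB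
  have hAB : ∀ v, A (B v) = v := by
    intro v
    have h1 : HasModelDerivAt (fun y => ψ (s, ψ (-s, y))) (A.comp B) z :=
      HasModelDerivAt.comp (G := fun x => ψ (s, x)) (F := fun x => ψ (-s, x))
        (by rw [hx]; exact hslice s x) (hslice (-s) z)
    have h2 : (fun y => ψ (s, ψ (-s, y))) = id := funext (h.neg s)
    rw [h2] at h1
    have h3 : HasModelDerivAt (id : M → M) (ContinuousLinearMap.id ℝ E) z := hasMFDerivAt_id z
    exact congrArg (fun L : E →L[ℝ] E => L v) (h1.modelDeriv_eq.symm.trans h3.modelDeriv_eq)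
  apply modelGrad_eq_of_forall
  intro v
  have h1 : HasMFDerivAt 𝓘(ℝ, E) 𝓘(ℝ, ℝ) (fun y => k (ψ (-s, y))) z
      ((modelDiff E k x).comp B) :=
    HasMFDerivAt.comp (g := k) (f := fun y => ψ (-s, y)) z
      (by rw [hx]; exact (hk.mdifferentiable (by simp) x).hasMFDerivAt) (hslice (-s) z)
  have h2 : HasMFDerivAt 𝓘(ℝ, E) 𝓘(ℝ, ℝ) (fun y => r * g y) z (r • modelDiff E g z) :=
    HasMFDerivAt.const_smul (hg.mdifferentiable (by simp) z).hasMFDerivAt r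
  have h3 : modelDiff E (fun y => r * g y + k (ψ (-s, y))) z =
      r • modelDiff E g z + (modelDiff E k x).comp B := modelDiff_eq (HasMFDerivAt.add h2 h1)
  -- Since `A (B v) = v`, invariance of the form yields `Ω(A X_k, v) = dk(B v)`, the differential of
  -- `k ∘ ψ_{-s}`.
  have h4 := h.symplectic s x (modelGrad E Ω k x) (B v)
  rw [← hA, hAB, formAt_modelGrad] at h4
  rw [formAt_add_left, formAt_smul_left, formAt_modelGrad, h3, h4]
  rfl

end HamiltonianFlow

/-! ### The Hofer speed of a deformed isotopy. -/

section Speed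

variable {E : Type*} [NormedAddCommGroup E] [NormedSpace ℝ E] [FiniteDimensional ℝ E]
  {M : Type*} [TopologicalSpace M] [ChartedSpace E M]

theorem exists_eq_add_const_of_modelDiff_eq [PreconnectedSpace M] [Nonempty M]
    [IsManifold 𝓘(ℝ, E) ∞ M] {h k : M → ℝ}
    (hh : ContMDiff 𝓘(ℝ, E) 𝓘(ℝ, ℝ) ∞ h) (hk : ContMDiff 𝓘(ℝ, E) 𝓘(ℝ, ℝ) ∞ k)
    (heq : ∀ x, modelDiff E h x = modelDiff E k x) : ∃ a, ∀ x, h x = k x + a := by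
  have hconst : IsLocallyConstant (fun x => h x - k x) := by
    rw [IsLocallyConstant.iff_eventually_eq]
    intro x
    set c := chartAt E x with hc
    have hxs : x ∈ c.source := mem_chart_source E x
    obtain ⟨r, hr, hball⟩ := Metric.isOpen_iff.1 c.open_target (c x) (c.map_source hxs)
    have hz : ∀ y ∈ Metric.ball (c x) r,
        HasFDerivAt (fun y => h (c.symm y) - k (c.symm y)) (0 : E →L[ℝ] ℝ) y := by
      intro y hy
      have hcs := hasModelDerivAt_chart_symm (chart_mem_atlas E x) (hball hy)
      have h1 : HasFDerivAt (fun y => h (c.symm y))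
          ((modelDiff E h (c.symm y)).comp (modelDeriv E c.symm y)) y :=
        hasMFDerivAt_iff_hasFDerivAt.1 (HasMFDerivAt.comp (g := h) y
          (hh.mdifferentiable (by simp) _).hasMFDerivAt hcs)
      have h2 : HasFDerivAt (fun y => k (c.symm y))
          ((modelDiff E k (c.symm y)).comp (modelDeriv E c.symm y)) y :=
        hasMFDerivAt_iff_hasFDerivAt.1 (HasMFDerivAt.comp (g := k) y
          (hk.mdifferentiable (by simp) _).hasMFDerivAt hcs)
      have h3 := h1.sub h2
      rwa [heq, sub_self] at h3
    have hmem : c.source ∩ c ⁻¹' Metric.ball (c x) r ∈ nhds x :=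
      Filter.inter_mem (c.open_source.mem_nhds hxs)
        ((c.continuousAt hxs).preimage_mem_nhds (Metric.ball_mem_nhds _ hr))
    filter_upwards [hmem] with y hy
    have h4 := Metric.isOpen_ball.is_const_of_fderiv_eq_zero (𝕜 := ℝ)
      (convex_ball (c x) r).isPreconnected
      (fun y hy => (hz y hy).differentiableAt.differentiableWithinAt)
      (fun y hy => (hz y hy).fderiv) hy.2 (Metric.mem_ball_self hr)
    simpa [c.left_inv hy.1, c.left_inv hxs] using h4
  obtain ⟨x₀⟩ := ‹Nonempty M›
  refine ⟨h x₀ - k x₀, fun x => ?_⟩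
  have := hconst.apply_eq_of_preconnectedSpace x x₀
  linarith

theorem totVar_add_const [Nonempty M] {k : M → ℝ} (ha : BddAbove (range k))
    (hb : BddBelow (range k)) (a : ℝ) : totVar (fun x => k x + a) = totVar k := by
  unfold totVar
  rw [← ciSup_add ha, ← ciInf_add hb]
  ring

theorem totVar_comp_surjective {k : M → ℝ} {F : M → M} (hF : Function.Surjective F) :
    totVar (fun x => k (F x)) = totVar k := by
  unfold totVar
  rw [hF.iSup_comp, hF.iInf_comp]

variable {Ω : SymplecticForm E M}

theorem modelDiff_eq_of_modelGrad_eq {h k : M → ℝ} {x : M}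
    (heq : modelGrad E Ω h x = modelGrad E Ω k x) : modelDiff E h x = modelDiff E k x := by
  ext v
  rw [← formAt_modelGrad Ω, heq, formAt_modelGrad]

/-- The Hofer speed of a path of surjective maps is the total variation of any compactly supported
function that generates its velocity. -/
theorem hoferSpeed_eq_totVar [ConnectedSpace M] [IsManifold 𝓘(ℝ, E) ∞ M] {γ : ℝ → M → M} {t : ℝ}
    (ht : t ∈ Icc (0 : ℝ) 1) (hγ : Function.Surjective (γ t)) {k : M → ℝ}
    (hk : ContMDiff 𝓘(ℝ, E) 𝓘(ℝ, ℝ) ∞ k) (hkc : HasCompactSupport k)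
    (hv : HasHamVelocityAt Ω γ k t) : hoferSpeed Ω γ t = totVar k := by
  have hset : {r | ∃ h : M → ℝ, ContMDiff 𝓘(ℝ, E) 𝓘(ℝ, ℝ) ∞ h ∧ HasCompactSupport h ∧
      HasHamVelocityAt Ω γ h t ∧ r = totVar h} = {totVar k} := by
    refine eq_singleton_iff_unique_mem.2 ⟨⟨k, hk, hkc, hv, rfl⟩, ?_⟩
    rintro r ⟨h, hh, -, hhv, rfl⟩
    -- Surjectivity of `γ t` lets the velocity determine the symplectic gradient at every point, so
    -- two generating functions differ by a constant.
    obtain ⟨a, ha⟩ := exists_eq_add_const_of_modelDiff_eq hh hk fun y => by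
      obtain ⟨x, rfl⟩ := hγ y
      exact modelDiff_eq_of_modelGrad_eq (Ω := Ω)
        (HasVelocityWithinAt.eq (uniqueDiffOn_Icc zero_lt_one t ht) (hhv x) (hv x))
    rw [show h = fun x => k x + a from funext ha]
    exact totVar_add_const (hk.continuous.bddAbove_range_of_hasCompactSupport hkc)
      (hk.continuous.bddBelow_range_of_hasCompactSupport hkc) a
  rw [hoferSpeed, hset, csInf_singleton]

theorem IsSmoothCompactFamily.contMDiff {H : ℝ → M → ℝ} (hH : IsSmoothCompactFamily E H) {t : ℝ}
    (ht : t ∈ Icc (0 : ℝ) 1) : ContMDiff 𝓘(ℝ, E) 𝓘(ℝ, ℝ) ∞ (H t) := by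
  have h1 : ContMDiff 𝓘(ℝ, E) (𝓘(ℝ, ℝ).prod 𝓘(ℝ, E)) ∞ (fun x : M => (t, x)) :=
    contMDiff_const.prodMk contMDiff_id
  rw [← contMDiffOn_univ] at h1 ⊢
  exact hH.smooth.comp h1 fun x _ => ⟨ht, mem_univ _⟩

/-- The speed at time `t` of the deformation of a Hamiltonian isotopy by `t(1 - t) g`. -/
theorem hoferSpeed_deformedPath [T2Space M] [ConnectedSpace M] [IsManifold 𝓘(ℝ, E) ∞ M]
    {φ : ℝ → Diffeomorph 𝓘(ℝ, E) 𝓘(ℝ, E) M M ∞} {H : ℝ → M → ℝ} (hφ : IsGeneratedBy Ω φ H)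
    {g : M → ℝ} {ψ : ℝ × M → M} (h : IsHamFlow Ω g ψ) (hg : ContMDiff 𝓘(ℝ, E) 𝓘(ℝ, ℝ) ∞ g)
    (hgc : HasCompactSupport g) (ε : ℝ) {t : ℝ} (ht : t ∈ Icc (0 : ℝ) 1) :
    hoferSpeed Ω (deformedPath Ω (fun t => φ t) (fun t x => t * (1 - t) * g x) ε) t =
      totVar (fun x => H t x + ε * (1 - 2 * t) * g x) := by
  -- At each `t` the deforming Hamiltonian is a multiple of the same `g`, so its time-1 map is `ψ`
  -- at time `ε t (1 - t)`.
  have hpath : deformedPath Ω (fun t => φ t) (fun t x => t * (1 - t) * g x) ε =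
      fun t x => ψ (ε * (t * (1 - t)), φ t x) := by
    funext t x
    have h1 := (h.const_mul hg (ε * (t * (1 - t)))).hamFlow_eq 1 (φ t x)
    simp only [mul_one, mul_assoc] at h1
    simp only [deformedPath, mul_assoc]
    exact h1
  rw [hpath]
  set s := ε * (t * (1 - t)) with hs
  set k : M → ℝ := fun y => ε * (1 - 2 * t) * g y + H t (ψ (-s, y)) with hk
  have hsurj : ∀ s, Function.Surjective fun x => ψ (s, x) := fun s y => ⟨ψ (-s, y), h.neg s y⟩
  have hH := hφ.family.contMDiff ht
  have hslice : ContMDiff 𝓘(ℝ, E) 𝓘(ℝ, E) ∞ fun y => ψ (-s, y) :=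
    h.smooth.comp (contMDiff_const.prodMk contMDiff_id)
  have hslice' : ContMDiff 𝓘(ℝ, E) 𝓘(ℝ, E) ∞ fun y => ψ (s, y) :=
    h.smooth.comp (contMDiff_const.prodMk contMDiff_id)
  have hksm : ContMDiff 𝓘(ℝ, E) 𝓘(ℝ, ℝ) ∞ k :=
    (contMDiff_const.mul hg).add (hH.comp hslice)
  obtain ⟨K, hK, hKH⟩ := hφ.family.compact
  have hkc : HasCompactSupport k := by
    refine HasCompactSupport.intro (hgc.isCompact.union (hK.image hslice'.continuous)) ?_
    intro y hy
    rw [mem_union, not_or] at hy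
    have h1 : ψ (-s, y) ∉ K := fun hmem => hy.2 ⟨_, hmem, h.neg s y⟩
    simp only [hk, hKH t ht _ h1, image_eq_zero_of_notMem_tsupport hy.1, mul_zero, add_zero]
  have hvel : HasHamVelocityAt Ω (fun t x => ψ (ε * (t * (1 - t)), φ t x)) k t := by
    intro x
    have hb : HasDerivAt (fun t : ℝ => ε * (t * (1 - t))) (ε * (1 - 2 * t)) t := by
      have h1 : HasDerivAt (fun t : ℝ => ε * (t * (1 - t))) (ε * (1 * (1 - t) + t * -1)) t :=
        ((hasDerivAt_id t).mul ((hasDerivAt_id t).const_sub 1)).const_mul ε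
      exact h1.congr_deriv (by ring)
    have h1 := h.velocity_comp hb (hφ.velocity t ht x)
    have h2 : modelGrad E Ω k (ψ (s, φ t x)) = _ := h.modelGrad_comp hg hH (ε * (1 - 2 * t)) s (φ t x)
    change HasVelocityWithinAt (fun t => ψ (ε * (t * (1 - t)), φ t x))
      (modelGrad E Ω k (ψ (s, φ t x))) (Icc 0 1) t
    rw [h2]
    exact h1
  -- Precomposing with `ψ_s` leaves the total variation unchanged, fixes `g` and cancels `ψ_{-s}`
  -- inside `H t`.
  rw [hoferSpeed_eq_totVar ht ((hsurj s).comp (φ t).surjective) hksm hkc hvel,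
    ← totVar_comp_surjective (hsurj s)]
  congr 1
  funext x
  simp only [hk, h.comp, h.neg']
  ring

end Speed

/-! ### Continuity and second differences of the total variation. -/

section TotalVariation

variable {M : Type*}

theorem sub_le_totVar {u : M → ℝ} (ha : BddAbove (range u)) (hb : BddBelow (range u)) (x y : M) :
    u x - u y ≤ totVar u :=
  sub_le_sub (le_ciSup ha x) (ciInf_le hb y)

theorem totVar_eq_of_mem {h : M → ℝ} {x P : M} (hx : x ∈ minset h) (hP : P ∈ maxset h) :
    totVar h = h P - h x := by
  have : Nonempty M := ⟨x⟩
  exact congrArg₂ (· - ·)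
    (le_antisymm (ciSup_le hP) (le_ciSup ⟨h P, forall_mem_range.2 hP⟩ P))
    (le_antisymm (ciInf_le ⟨h x, forall_mem_range.2 hx⟩ x) (le_ciInf hx))

theorem totVar_le_add [Nonempty M] {u v : M → ℝ} (ha : BddAbove (range v))
    (hb : BddBelow (range v)) {d : ℝ} (huv : ∀ x, |u x - v x| ≤ d) :
    totVar u ≤ totVar v + 2 * d := by
  have h1 : ⨆ x, u x ≤ (⨆ x, v x) + d := ciSup_le fun x => by
    linarith [(abs_le.1 (huv x)).2, le_ciSup ha x]
  have h2 : (⨅ x, v x) - d ≤ ⨅ x, u x := le_ciInf fun x => by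
    linarith [(abs_le.1 (huv x)).1, ciInf_le hb x]
  unfold totVar
  linarith

variable [TopologicalSpace M]

/-- A continuous family, parametrized by `[0,1]`, of functions supported in a common
compact set. -/
structure IsContinuousCompactFamily (u : ℝ → M → ℝ) : Prop where
  continuousOn : ContinuousOn (fun z : ℝ × M => u z.1 z.2) (Icc 0 1 ×ˢ univ)
  compact : ∃ K : Set M, IsCompact K ∧ ∀ t ∈ Icc (0 : ℝ) 1, ∀ x ∉ K, u t x = 0

theorem IsContinuousCompactFamily.continuous {u : ℝ → M → ℝ} (hu : IsContinuousCompactFamily u)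
    {t : ℝ} (ht : t ∈ Icc (0 : ℝ) 1) : Continuous (u t) :=
  continuousOn_univ.1
    (hu.continuousOn.comp (f := fun x : M => (t, x)) (by fun_prop) fun _ _ => ⟨ht, mem_univ _⟩)

theorem IsContinuousCompactFamily.bdd [R1Space M] {u : ℝ → M → ℝ}
    (hu : IsContinuousCompactFamily u) {t : ℝ} (ht : t ∈ Icc (0 : ℝ) 1) :
    BddAbove (range (u t)) ∧ BddBelow (range (u t)) := by
  obtain ⟨K, hK, hKu⟩ := hu.compact
  have hc : HasCompactSupport (u t) := HasCompactSupport.intro hK (hKu t ht)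
  exact ⟨(hu.continuous ht).bddAbove_range_of_hasCompactSupport hc,
    (hu.continuous ht).bddBelow_range_of_hasCompactSupport hc⟩

/-- Compactness of `K` makes `u t` uniformly close to `u t₀`. The continuity serves to make the
speeds integrable, so that the integral of a second difference can be split. -/
theorem IsContinuousCompactFamily.continuousOn_totVar [R1Space M] [Nonempty M] {u : ℝ → M → ℝ}
    (hu : IsContinuousCompactFamily u) : ContinuousOn (fun t => totVar (u t)) (Icc 0 1) := by
  obtain ⟨K, hK, hKu⟩ := hu.compact
  rw [continuousOn_iff_continuous_domRestrict, continuous_iff_continuousAt]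
  intro t₀
  rw [Metric.continuousAt_iff']
  intro e he
  have hv : Continuous fun z : Icc (0 : ℝ) 1 × M => u z.1 z.2 :=
    hu.continuousOn.comp_continuous (f := fun z : Icc (0 : ℝ) 1 × M => ((z.1 : ℝ), z.2))
      (by fun_prop) fun z => ⟨z.1.2, mem_univ _⟩
  have h1 : ∀ᶠ t : Icc (0 : ℝ) 1 in nhds t₀, ∀ x ∈ K, |u t x - u t₀ x| < e / 4 := by
    refine hK.eventually_forall_of_forall_eventually fun x _ => ?_
    have hc : Continuous fun z : Icc (0 : ℝ) 1 × M => |u z.1 z.2 - u t₀ z.2| :=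
      (hv.sub (hv.comp (continuous_const.prodMk continuous_snd))).abs
    refine hc.continuousAt.eventually_lt continuousAt_const ?_
    simpa using he
  filter_upwards [h1] with t ht
  have h2 : ∀ x, |u t x - u t₀ x| ≤ e / 4 := by
    intro x
    by_cases hx : x ∈ K
    · exact (ht x hx).le
    · rw [hKu t t.2 x hx, hKu t₀ t₀.2 x hx, sub_self, abs_zero]
      positivity
  obtain ⟨ha, hb⟩ := hu.bdd t.2
  obtain ⟨ha₀, hb₀⟩ := hu.bdd t₀.2
  have h3 := totVar_le_add ha₀ hb₀ h2
  have h4 := totVar_le_add ha hb fun x => by rw [abs_sub_comm]; exact h2 x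
  rw [Real.dist_eq, abs_lt]
  simp only [domRestrict_apply]
  constructor <;> linarith

/-- Second differences of the total variation bound the oscillation on the set of minima. -/
theorem mul_sub_le_of_mem_minset {h g : M → ℝ} {r : ℝ} {x y P : M} (hx : x ∈ minset h)
    (hy : y ∈ minset h) (hP : P ∈ maxset h)
    (h₁ : BddAbove (range fun x => h x + r * g x)) (h₂ : BddBelow (range fun x => h x + r * g x))
    (h₃ : BddAbove (range fun x => h x + -r * g x))
    (h₄ : BddBelow (range fun x => h x + -r * g x)) :
    r * (g y - g x) ≤ totVar (fun x => h x + r * g x) + totVar (fun x => h x + -r * g x)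
      - 2 * totVar h := by
  -- The two perturbations are tested with different minima `x`, `y` and the same `P`, so the values
  -- of `g` at `P` cancel.
  have h5 := sub_le_totVar h₁ h₂ P x
  have h6 := sub_le_totVar h₃ h₄ P y
  have h7 := totVar_eq_of_mem hx hP
  have h8 := totVar_eq_of_mem hy hP
  linarith

/-- Second differences of the total variation bound the oscillation on the set of maxima. -/
theorem mul_sub_le_of_mem_maxset {h g : M → ℝ} {r : ℝ} {x y p : M} (hx : x ∈ maxset h)
    (hy : y ∈ maxset h) (hp : p ∈ minset h)
    (h₁ : BddAbove (range fun x => h x + r * g x)) (h₂ : BddBelow (range fun x => h x + r * g x))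
    (h₃ : BddAbove (range fun x => h x + -r * g x))
    (h₄ : BddBelow (range fun x => h x + -r * g x)) :
    r * (g y - g x) ≤ totVar (fun x => h x + r * g x) + totVar (fun x => h x + -r * g x)
      - 2 * totVar h := by
  have h5 := sub_le_totVar h₁ h₂ y p
  have h6 := sub_le_totVar h₃ h₄ x p
  have h7 := totVar_eq_of_mem hp hx
  have h8 := totVar_eq_of_mem hp hy
  linarith

end TotalVariation

/-! ### Second differences and integrals tending to zero. -/

section Calculus

open Filter Topology

/-- The even function `f ε + f (-ε)` has derivative `0` at `0`; the expression is its slope at `ε =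
1 / (n + 1)`. -/
theorem tendsto_second_difference {f : ℝ → ℝ} (hf : DifferentiableAt ℝ f 0) :
    Tendsto (fun n : ℕ => ((n : ℝ) + 1) *
      (f (1 / ((n : ℝ) + 1)) + f (-(1 / ((n : ℝ) + 1))) - 2 * f 0)) atTop (𝓝 0) := by
  have h1 : HasDerivAt (fun ε => f (-ε)) (-deriv f 0) 0 := by
    have h := HasDerivAt.comp (h₂ := f) (h := fun ε : ℝ => -ε) 0
      (by rw [neg_zero]; exact hf.hasDerivAt) (hasDerivAt_neg 0)
    simpa [Function.comp_def] using h
  have h2 : HasDerivAt (fun ε => f ε + f (-ε)) 0 0 := by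
    have h : HasDerivAt (fun ε => f ε + f (-ε)) (deriv f 0 + -deriv f 0) 0 :=
      hf.hasDerivAt.add h1
    rwa [add_neg_cancel] at h
  have h3 : Tendsto (fun n : ℕ => 1 / ((n : ℝ) + 1)) atTop (𝓝[≠] 0) :=
    tendsto_nhdsWithin_iff.2 ⟨tendsto_one_div_add_atTop_nhds_zero_nat,
      Eventually.of_forall fun n => by
        have : (0 : ℝ) < 1 / ((n : ℝ) + 1) := by positivity
        exact this.ne'⟩
  refine ((hasDerivAt_iff_tendsto_slope_zero.1 h2).comp h3).congr fun n => ?_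
  simp only [Function.comp_apply, zero_add, neg_zero, smul_eq_mul, one_div, inv_inv]
  ring

/-- If nonnegative functions have integrals tending to zero, then almost everywhere they have no
common positive lower bound. -/
theorem ae_forall_le_of_tendsto_integral {α : Type*} [MeasurableSpace α] {μ : Measure α}
    {ρ : ℕ → α → ℝ} (hρ : ∀ n, Integrable (ρ n) μ) (h0 : ∀ n, 0 ≤ᵐ[μ] ρ n)
    (hlim : Tendsto (fun n => ∫ a, ρ n a ∂μ) atTop (𝓝 0)) :
    ∀ᵐ a ∂μ, ∀ b : ℝ, (∀ n, b ≤ ρ n a) → b ≤ 0 := by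
  have hm : AEMeasurable (fun a => ⨅ n, ENNReal.ofReal (ρ n a)) μ :=
    AEMeasurable.iInf fun n => (hρ n).aemeasurable.ennreal_ofReal
  -- The pointwise infimum has integral below every term, hence zero. No almost everywhere
  -- convergence or subsequence is needed.
  have h1 : ∫⁻ a, ⨅ n, ENNReal.ofReal (ρ n a) ∂μ = 0 := by
    refine le_antisymm (ge_of_tendsto' (x := atTop) ?_ fun n : ℕ => lintegral_mono fun a =>
      iInf_le (fun n => ENNReal.ofReal (ρ n a)) n) zero_le
    have h3 := ENNReal.tendsto_ofReal hlim
    rw [ENNReal.ofReal_zero] at h3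
    exact h3.congr fun n => ofReal_integral_eq_lintegral_ofReal (hρ n) (h0 n)
  filter_upwards [(lintegral_eq_zero_iff' hm).1 h1] with a ha b hb
  have h4 : ENNReal.ofReal b ≤ ⨅ n, ENNReal.ofReal (ρ n a) :=
    le_iInf fun n => ENNReal.ofReal_le_ofReal (hb n)
  rw [ha] at h4
  exact ENNReal.ofReal_eq_zero.1 (le_antisymm h4 zero_le)

end Calculus

/-! ### Test Hamiltonians and the consequence of smoothness of the length. -/

section SmoothPoint

open Filter Topology

variable {E : Type*} [NormedAddCommGroup E] [NormedSpace ℝ E] [FiniteDimensional ℝ E]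
  {M : Type*} [TopologicalSpace M] [T2Space M] [ConnectedSpace M]
  [ChartedSpace E M] [IsManifold 𝓘(ℝ, E) ∞ M] {Ω : SymplecticForm E M}

/-- Around every point `q` there is a Hamiltonian with a global flow that takes the value `1`
exactly at `q`. -/
theorem exists_isHamFlow_eq_one_iff (Ω : SymplecticForm E M) (q : M) :
    ∃ (g : M → ℝ) (ψ : ℝ × M → M), ContMDiff 𝓘(ℝ, E) 𝓘(ℝ, ℝ) ∞ g ∧ HasCompactSupport g ∧
      IsHamFlow Ω g ψ ∧ ∀ x, g x = 1 ↔ x = q := by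
  set c := chartAt E q with hc
  have hq : q ∈ c.source := mem_chart_source E q
  have hcat : c ∈ atlas E M := chart_mem_atlas E q
  obtain ⟨r, hr, hball⟩ := Metric.nhds_basis_closedBall.mem_iff.1
    (c.open_target.mem_nhds (c.map_source hq))
  obtain ⟨f, hf, -, hf0, hf1⟩ := exists_contMDiff_zero_iff_one_iff_of_isClosed 𝓘(ℝ, E) (n := (⊤ : ℕ∞))
    (Metric.isOpen_ball (x := c q) (ε := r)).isClosed_compl (isClosed_singleton (x := c q))
    (disjoint_singleton_right.2 fun h => h (Metric.mem_ball_self hr))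
  have hfs : ContDiff ℝ ∞ f := hf.contDiff
  have hsupp : tsupport f ⊆ Metric.closedBall (c q) r := by
    refine closure_minimal (fun y hy => ?_) Metric.isClosed_closedBall
    by_contra h
    exact hy ((hf0 y).1 fun h' => h (Metric.ball_subset_closedBall h'))
  have hfc : HasCompactSupport f :=
    (isCompact_closedBall (c q) r).of_isClosed_subset (isClosed_tsupport f) hsupp
  have hU : tsupport f ⊆ c.target := hsupp.trans hball
  obtain ⟨Ψ, hΨ⟩ := exists_isFlow ((isSymplecticOn_chartExpr Ω hcat).contDiff_hamField hfs hU)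
    (hasCompactSupport_hamField hfc)
  refine ⟨chartFun c f, chartFlow c Ψ, contMDiff_chartFun hcat hfs hfc hU,
    hasCompactSupport_chartFun hfc hU, isHamFlow_chartFlow hcat hfs hfc hU hΨ, fun x => ?_⟩
  by_cases hx : x ∈ c.source
  · rw [chartFun_of_mem hx, ← hf1, mem_singleton_iff]
    exact c.injOn.eq_iff hx hq
  · rw [chartFun, if_neg hx]
    exact ⟨fun h => absurd h zero_ne_one, fun h => absurd (h ▸ hq) hx⟩

/-- The factor `t(1-t)` vanishes at both endpoints, while its derivative `1-2t`, which enters the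
speed, vanishes only at `t = 1/2`. -/
theorem isTangentField_bump {g : M → ℝ} (hg : ContMDiff 𝓘(ℝ, E) 𝓘(ℝ, ℝ) ∞ g)
    (hgc : HasCompactSupport g) : IsTangentField E (fun t x => t * (1 - t) * g x) := by
  refine ⟨⟨?_, tsupport g, hgc, fun t _ x hx => ?_⟩, fun x => by simp, fun x => by simp⟩
  · have h1 : ContMDiff (𝓘(ℝ, ℝ).prod 𝓘(ℝ, E)) 𝓘(ℝ, ℝ) ∞ fun z : ℝ × M => z.1 * (1 - z.1) :=
      ContMDiff.comp (g := fun t : ℝ => t * (1 - t)) (ContDiff.contMDiff (by fun_prop))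
        contMDiff_fst
    exact (h1.mul (hg.comp contMDiff_snd)).contMDiffOn
  · rw [image_eq_zero_of_notMem_tsupport hx, mul_zero]

theorem isContinuousCompactFamily_add {H : ℝ → M → ℝ} (hH : IsSmoothCompactFamily E H)
    {g : M → ℝ} (hg : Continuous g) (hgc : HasCompactSupport g) (ε : ℝ) :
    IsContinuousCompactFamily (fun t x => H t x + ε * (1 - 2 * t) * g x) := by
  obtain ⟨K, hK, hKH⟩ := hH.compact
  refine ⟨hH.smooth.continuousOn.add (Continuous.continuousOn (by fun_prop)), K ∪ tsupport g,
    hK.union hgc, fun t ht x hx => ?_⟩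
  rw [mem_union, not_or] at hx
  rw [hKH t ht x hx.1, image_eq_zero_of_notMem_tsupport hx.2, mul_zero, add_zero]

/-- At a smooth point of the length functional, every Hamiltonian with a global flow is constant
on the sets of minima and of maxima of the generating Hamiltonian, at almost every time. -/
theorem ae_constant_on_minset_maxset
    {φ : ℝ → Diffeomorph 𝓘(ℝ, E) 𝓘(ℝ, E) M M ∞} {H : ℝ → M → ℝ} (hφ : IsGeneratedBy Ω φ H)
    (hmin : ∀ t ∈ Icc (0 : ℝ) 1, (minset (H t)).Nonempty)
    (hmax : ∀ t ∈ Icc (0 : ℝ) 1, (maxset (H t)).Nonempty)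
    (hsmooth : IsSmoothPoint Ω (fun t => φ t)) {g : M → ℝ} {ψ : ℝ × M → M}
    (h : IsHamFlow Ω g ψ) (hg : ContMDiff 𝓘(ℝ, E) 𝓘(ℝ, ℝ) ∞ g) (hgc : HasCompactSupport g) :
    ∀ᵐ t ∂(volume.restrict (Icc (0 : ℝ) 1)),
      (∀ x ∈ minset (H t), ∀ y ∈ minset (H t), g x = g y) ∧
      (∀ x ∈ maxset (H t), ∀ y ∈ maxset (H t), g x = g y) := by
  set v : ℝ → ℝ → ℝ := fun ε t => totVar (fun x => H t x + ε * (1 - 2 * t) * g x) with hv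
  have hfam := fun ε => isContinuousCompactFamily_add hφ.family hg.continuous hgc ε
  have hint : ∀ ε, Integrable (v ε) (volume.restrict (Icc (0 : ℝ) 1)) := fun ε =>
    (hfam ε).continuousOn_totVar.integrableOn_Icc
  have hL : ∀ ε, hoferLength Ω (deformedPath Ω (fun t => φ t) (fun t x => t * (1 - t) * g x) ε) =
      ∫ t in Icc (0 : ℝ) 1, v ε t := by
    intro ε
    rw [hoferLength, intervalIntegral.integral_of_le zero_le_one, ← integral_Icc_eq_integral_Ioc]
    exact setIntegral_congr_fun measurableSet_Icc fun t ht =>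
      hoferSpeed_deformedPath hφ h hg hgc ε ht
  have hdiff := hsmooth _ (isTangentField_bump hg hgc)
  simp only [hL] at hdiff
  set ρ : ℕ → ℝ → ℝ := fun n t => ((n : ℝ) + 1) *
    (v (1 / ((n : ℝ) + 1)) t + v (-(1 / ((n : ℝ) + 1))) t - 2 * v 0 t) with hρ
  have hρint : ∀ n, Integrable (ρ n) (volume.restrict (Icc (0 : ℝ) 1)) := fun n =>
    (((hint _).add (hint _)).sub ((hint 0).const_mul 2)).const_mul _
  have hlim : Tendsto (fun n => ∫ t in Icc (0 : ℝ) 1, ρ n t) atTop (𝓝 0) := by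
    refine (tendsto_second_difference hdiff).congr fun n => ?_
    have e1 := integral_sub ((hint (1 / ((n : ℝ) + 1))).add (hint (-(1 / ((n : ℝ) + 1)))))
      ((hint 0).const_mul 2)
    rw [integral_add' (hint _) (hint _), integral_const_mul] at e1
    exact (congrArg (((n : ℝ) + 1) * ·) e1.symm).trans (integral_const_mul _ _).symm
  have hb : ∀ ε t, t ∈ Icc (0 : ℝ) 1 → BddAbove (range fun x => H t x + ε * (1 - 2 * t) * g x) ∧
      BddBelow (range fun x => H t x + ε * (1 - 2 * t) * g x) := fun ε t ht => (hfam ε).bdd ht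
  have hscale : ∀ (n : ℕ) (a b : ℝ), 1 / ((n : ℝ) + 1) * a ≤ b → a ≤ ((n : ℝ) + 1) * b := by
    intro n a b hab
    have hn : (0 : ℝ) < (n : ℝ) + 1 := by positivity
    rw [one_div, inv_mul_le_iff₀ hn] at hab
    exact hab
  have hv0 : ∀ t, v 0 t = totVar (H t) := by
    intro t
    simp [hv]
  have hmins : ∀ t ∈ Icc (0 : ℝ) 1, ∀ x ∈ minset (H t), ∀ y ∈ minset (H t), ∀ n,
      (1 - 2 * t) * (g y - g x) ≤ ρ n t := by
    intro t ht x hx y hy n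
    obtain ⟨P, hP⟩ := hmax t ht
    obtain ⟨h1, h2⟩ := hb (1 / ((n : ℝ) + 1)) t ht
    obtain ⟨h3, h4⟩ := hb (-(1 / ((n : ℝ) + 1))) t ht
    rw [neg_mul] at h3 h4
    have h5 := mul_sub_le_of_mem_minset hx hy hP h1 h2 h3 h4
    refine hscale n _ _ ?_
    rw [hv0, ← mul_assoc]
    simpa only [hv, neg_mul] using h5
  have hmaxs : ∀ t ∈ Icc (0 : ℝ) 1, ∀ x ∈ maxset (H t), ∀ y ∈ maxset (H t), ∀ n,
      (1 - 2 * t) * (g y - g x) ≤ ρ n t := by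
    intro t ht x hx y hy n
    obtain ⟨p, hp⟩ := hmin t ht
    obtain ⟨h1, h2⟩ := hb (1 / ((n : ℝ) + 1)) t ht
    obtain ⟨h3, h4⟩ := hb (-(1 / ((n : ℝ) + 1))) t ht
    rw [neg_mul] at h3 h4
    have h5 := mul_sub_le_of_mem_maxset hx hy hp h1 h2 h3 h4
    refine hscale n _ _ ?_
    rw [hv0, ← mul_assoc]
    simpa only [hv, neg_mul] using h5
  -- Nonnegativity is the case `y = x` of `hmins`.
  have hρ0 : ∀ n, 0 ≤ᵐ[volume.restrict (Icc (0 : ℝ) 1)] ρ n := by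
    intro n
    filter_upwards [ae_restrict_mem measurableSet_Icc] with t ht
    obtain ⟨x, hx⟩ := hmin t ht
    simpa using hmins t ht x hx x hx n
  have hhalf : ∀ᵐ t ∂(volume.restrict (Icc (0 : ℝ) 1)), t ≠ 1 / 2 :=
    ae_restrict_of_ae (Measure.ae_ne volume _)
  -- Exchanging `x` and `y` gives both inequalities, so the sign of `1 - 2 * t` does not matter.
  have hzero : ∀ t a b : ℝ, t ≠ 1 / 2 → (1 - 2 * t) * (a - b) ≤ 0 → (1 - 2 * t) * (b - a) ≤ 0 →
      b = a := by
    intro t a b ht h1 h2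
    have h3 : (1 - 2 * t) * (a - b) = 0 := by linarith
    rcases mul_eq_zero.1 h3 with h4 | h4
    · exact absurd (by linarith) ht
    · linarith
  filter_upwards [ae_forall_le_of_tendsto_integral hρint hρ0 hlim,
    ae_restrict_mem measurableSet_Icc, hhalf] with t h1 ht hne
  exact ⟨fun x hx y hy => hzero t _ _ hne (h1 _ (hmins t ht x hx y hy))
      (h1 _ (hmins t ht y hy x hx)),
    fun x hx y hy => hzero t _ _ hne (h1 _ (hmaxs t ht x hx y hy))
      (h1 _ (hmaxs t ht y hy x hx))⟩

end SmoothPoint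

end HoferGeometry

end

theorem mainTheorem6
    {E : Type*} [NormedAddCommGroup E] [NormedSpace ℝ E] [FiniteDimensional ℝ E]
    {M : Type*} [TopologicalSpace M] [T2Space M] [SecondCountableTopology M] [ConnectedSpace M]
    [ChartedSpace E M] [IsManifold 𝓘(ℝ, E) ∞ M]
    (Ω : SymplecticForm E M)
    (φ : ℝ → Diffeomorph 𝓘(ℝ, E) 𝓘(ℝ, E) M M ∞) (H : ℝ → M → ℝ)
    (hφ₀ : φ 0 ∈ hamGroup Ω)
    (hφ : IsGeneratedBy Ω φ H)
    (hmin : (⋂ t ∈ Icc (0 : ℝ) 1, minset (H t)).Nonempty)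
    (hmax : (⋂ t ∈ Icc (0 : ℝ) 1, maxset (H t)).Nonempty)
    (hsmooth : IsSmoothPoint Ω (fun t => φ t)) :
    ∃ p P : M,
      (⋂ t ∈ Icc (0 : ℝ) 1, minset (H t)) = {p} ∧
      (⋂ t ∈ Icc (0 : ℝ) 1, maxset (H t)) = {P} ∧
      ∀ᵐ t ∂(volume.restrict (Icc (0 : ℝ) 1)), minset (H t) = {p} ∧ maxset (H t) = {P} := by
  obtain ⟨p, hp⟩ := hmin
  obtain ⟨P, hP⟩ := hmax
  rw [mem_iInter₂] at hp hP
  have hconst : ∀ q : M, ∃ g : M → ℝ, (∀ x, g x = 1 ↔ x = q) ∧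
      ∀ᵐ t ∂(volume.restrict (Icc (0 : ℝ) 1)),
        (∀ x ∈ minset (H t), ∀ y ∈ minset (H t), g x = g y) ∧
        (∀ x ∈ maxset (H t), ∀ y ∈ maxset (H t), g x = g y) := by
    intro q
    obtain ⟨g, ψ, hg, hgc, hψ, hone⟩ := exists_isHamFlow_eq_one_iff Ω q
    exact ⟨g, hone, ae_constant_on_minset_maxset hφ (fun t ht => ⟨p, hp t ht⟩)
      (fun t ht => ⟨P, hP t ht⟩) hsmooth hψ hg hgc⟩
  obtain ⟨g, hg, hgae⟩ := hconst p
  obtain ⟨k, hk, hkae⟩ := hconst P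
  have hae : ∀ᵐ t ∂(volume.restrict (Icc (0 : ℝ) 1)),
      t ∈ Icc (0 : ℝ) 1 ∧ minset (H t) = {p} ∧ maxset (H t) = {P} := by
    filter_upwards [hgae, hkae, ae_restrict_mem measurableSet_Icc] with t h1 h2 ht
    refine ⟨ht, eq_singleton_iff_unique_mem.2 ⟨hp t ht, fun x hx => ?_⟩,
      eq_singleton_iff_unique_mem.2 ⟨hP t ht, fun x hx => ?_⟩⟩
    · rw [← hg, h1.1 x hx p (hp t ht), hg]
    · rw [← hk, h2.2 x hx P (hP t ht), hk]
  have hne : (ae (volume.restrict (Icc (0 : ℝ) 1))).NeBot := by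
    rw [ae_neBot, Ne, Measure.restrict_eq_zero, Real.volume_Icc]
    simp
  -- A single good time suffices: the intersections lie in the singletons found at that `t`.
  obtain ⟨t, ht, htmin, htmax⟩ := hae.exists
  refine ⟨p, P, eq_singleton_iff_unique_mem.2 ⟨mem_iInter₂.2 hp, fun x hx => ?_⟩,
    eq_singleton_iff_unique_mem.2 ⟨mem_iInter₂.2 hP, fun x hx => ?_⟩, hae.mono fun t ht => ht.2⟩
  · have := mem_iInter₂.1 hx t ht
    rwa [htmin] at this
  · have := mem_iInter₂.1 hx t ht
    rwa [htmax] at this
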